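/- **Setting.** Let $d\ge 0$, $\Pi=\mathbb Z^d\subset\mathbb R^d$, let $V$ be a finite-dimensional complex Hilbert space and $\mathscr H=L^2(\mathbb R^d,V)$. Let $\mathbb Z_2=\{1,-1\}$ be graded by the identity $\phi:\mathbb Z_2\to\{\pm1\}$, and let $1\to U(1)\xrightarrow{\iota}(\mathbb Z_2)_{\rm qu}\xrightarrow{q}\mathbb Z_2\to1$ be a quantum extension, i.e. a short exact sequence of topological groups with $g\,\iota(u)=\iota(u)^{\phi(q(g))}g$; it is called trivial if it splits by a homomorphism. Let $\mathsf G_{\rm qu}=(\mathbb Z^d\times U(1))\times_{U(1)}(\mathbb Z_2)_{\rm qu}=\mathbb Z^d\times(\mathbb Z_2)_{\rm qu}$ act on $\mathscr H$ by a strongly continuous homomorphism $\rho$ to the group of unitary and antiunitary operators, such that $\rho(n,g)$ is unitary if $q(g)=1$ and antiunitary if $q(g)=-1$, $\rho(0,\iota(u))=u\,\mathbb 1$, $(\rho(n,1)\psi)(x)=\psi(x-n)$, and each $\rho(0,g)$ acts over the identity of $\mathbb R^d$ (if $\psi=0$ a.e. on a measurable set $S$, then $\rho(0,g)\psi=0$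 a.e. on $S$). Let $H$ be a densely defined selfadjoint operator on $\mathscr H$ with bounded inverse that commutes with $\rho(\mathsf G_{\rm qu})$. Let $X_\Pi=\mathrm{Hom}(\mathbb Z^d,U(1))\cong\mathbb T^d$ be the Brillouin torus, with the involution $\tau(\lambda)=\lambda^{-1}$, and let $E\to X_\Pi$ be the smooth Hilbert bundle whose fibre $E_\lambda$ consists of the functions $\psi:\mathbb R^d\to V$ with $\psi(x-n)=\lambda(n)\psi(x)$ for $n\in\mathbb Z^d$ that are square-integrable on $[0,1)^d$. Restriction to $[0,1)^d$ is a unitary isomorphism $E_\lambda\cong L^2([0,1)^d,V)$, and these isomorphisms form a smooth trivialisation of $E$. Let $\mathrm U:\mathscr H\to L^2(X_\Pi,E)$ be the unitary isomorphism with inverse $(\mathrm U^{-1}s)(x)=\int_{X_\Pi}s(\lambda)(x)\,d\lambda$. For a fixed origin $x_0\in\mathbb R^d$, let $\nabla^E$ be the connection on $E$ whose parallel transport along a path $\lambda_t=e^{2\pi i\langle k_t,-\rangle}$ is $\psi\mapsto e^{-2\pi i\langle k_t-k_0,\,x-x_0\rangle}\psi$. Assume that $H$ is the direct integral under $\mathrm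 U$ of a family of densely defined selfadjoint operators $H_\lambda$ on $E_\lambda$ (the Bloch Hamiltonians) that have bounded inverses depending continuously in norm on $\lambda$, that the negative spectral subspace $E^-_\lambda$ of each $H_\lambda$ has finite dimension, and that these subspaces form a smooth subbundle $E^-\subset E$, the Bloch bundle. Let $\nabla^{E^-}=\mathrm{pr}_{E^-}\circ\nabla^E$ be the Berry connection on $E^-$. A Real (respectively Quaternionic) vector bundle over $(X_\Pi,\tau)$ is a Hermitian vector bundle $K$ of finite rank with a smooth antiunitary lift $\hat\tau$ of $\tau$ to $K$, i.e. an isomorphism $\hat\tau:\overline{\tau^*K}\to K$ of Hermitian vector bundles, such that $\hat\tau\circ\overline{\tau^*\hat\tau}=+\mathbb 1$ (respectively $-\mathbb 1$); it is one with connection if $K$ carries a connection preserved by $\hat\tau$. **Proposition.** The Berry connection $\nabla^{E^-}$ is a Hermitian connection on $E^-$. Let $\hat T\in(\mathbb Z_2)_{\rm qu}$ be any lift of $-1$. There is a smooth antiunitary lift $\hat\tau$ of $\tau$ to $E$ that corresponds to $\rho(0,\hat T)$ under $\mathrm U$, i.e. $(\mathrm U\rho(0,\hat T)\psi)(\lambda)=\hat\tau\big((\mathrm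 U\psi)(\lambda^{-1})\big)$ for all $\psi\in\mathscr H$ and almost all $\lambda$, and such that: 1. If $(\mathbb Z_2)_{\rm qu}$ is the trivial quantum extension, then $\hat\tau$ restricts to $E^-$ and makes $(E^-,\nabla^{E^-})$ a Real vector bundle with connection over $(X_\Pi,\tau)$. 2. If $(\mathbb Z_2)_{\rm qu}$ is nontrivial, then $\hat\tau$ restricts to $E^-$ and makes $E^-$ a Quaternionic vector bundle over $(X_\Pi,\tau)$. For every connection $\nabla$ on $E^-$, the average $\mathrm{av}(\nabla)=\tfrac12\big(\nabla+\hat\tau\circ\overline{\tau^*\nabla}\circ\hat\tau^{-1}\big)$ over $\mathbb Z_2$ is a connection on $E^-$ preserved by $\hat\tau$. In particular $(E^-,\mathrm{av}(\nabla^{E^-}))$ is a Quaternionic vector bundle with connection, and $\mathrm{av}(\nabla^{E^-})$ is Hermitian. -/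

import Mathlib

open MeasureTheory Topology

open scoped ComplexConjugate InnerProductSpace

namespace BlochTheory

/-! ### Quantum extensions -/

/-- A quantum extension `1 → U(1) → Gqu → G → 1` of a topological group `G` with grading
`φ : G → ℤ₂ = {1, -1}`: a short exact sequence of topological groups in which
`g ι(u) = ι(u) ^ φ(g) g`. -/
structure QuantumExtension (G Gqu : Type*) [Group G] [TopologicalSpace G] [Group Gqu]
    [TopologicalSpace Gqu] (φ : G →* ℤˣ) where
  /-- the inclusion of `U(1)` -/
  ι : Circle →* Gqu
  /-- the projection to `G` -/
  q : Gqu →* G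
  isEmbedding_ι : IsEmbedding ι
  isOpenQuotientMap_q : IsOpenQuotientMap q
  exact : ι.range = q.ker
  twist : ∀ (g : Gqu) (u : Circle), g * ι u = ι (u ^ ((φ (q g) : ℤˣ) : ℤ)) * g

/-- A quantum extension is trivial when it is split, that is, isomorphic to the semidirect product
of `U(1)` and `G`, where `g` acts on `U(1)` by `u ↦ u ^ φ(g)`. -/
def QuantumExtension.IsTrivial {G Gqu : Type*} [Group G] [TopologicalSpace G] [Group Gqu]
    [TopologicalSpace Gqu] {φ : G →* ℤˣ} (e : QuantumExtension G Gqu φ) : Prop :=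
  ∃ s : G →* Gqu, Continuous s ∧ ∀ g, e.q (s g) = g

section Hilbert

variable {H : Type*} [NormedAddCommGroup H] [InnerProductSpace ℂ H]

/-- Unitary bijections of a Hilbert space. -/
structure IsUnitaryMap (T : Equiv.Perm H) : Prop where
  linear : ∀ (a : ℂ) (ψ χ : H), T (a • ψ + χ) = a • T ψ + T χ
  inner : ∀ ψ χ : H, ⟪T ψ, T χ⟫_ℂ = ⟪ψ, χ⟫_ℂ

/-- Antiunitary bijections of a Hilbert space. -/
structure IsAntiunitaryMap (T : Equiv.Perm H) : Prop where
  antilinear : ∀ (a : ℂ) (ψ χ : H), T (a • ψ + χ) = conj a • T ψ + T χ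
  inner : ∀ ψ χ : H, ⟪T ψ, T χ⟫_ℂ = conj ⟪ψ, χ⟫_ℂ

/-- `B` is the (everywhere defined, bounded) inverse of the unbounded operator `A`. -/
def IsBoundedInverse (A : H →ₗ.[ℂ] H) (B : H →L[ℂ] H) : Prop :=
  (∀ y, (B y, y) ∈ A.graph) ∧ ∀ x : A.domain, B (A x) = x

/-- The span of the eigenvectors of `A` with negative eigenvalue. -/
def negativeEigenspace (A : H →ₗ.[ℂ] H) : Submodule ℂ H :=
  Submodule.span ℂ {v | ∃ μ : ℝ, μ < 0 ∧ (v, (μ : ℂ) • v) ∈ A.graph}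

end Hilbert

/-! ### Lattice, Brillouin torus and smooth bundles over it -/

/-- Physical space `ℝᵈ`; also the space of momenta, paired with positions by the inner product. -/
abbrev Space (d : ℕ) : Type := EuclideanSpace ℝ (Fin d)

/-- The vector of `ℝᵈ` given by an element of the lattice `ℤᵈ`. -/
noncomputable def latticeVec {d : ℕ} (n : Fin d → ℤ) : Space d :=
  WithLp.toLp 2 (fun i => (n i : ℝ))

/-- The Brillouin torus: the Pontryagin dual `Hom(ℤᵈ, U(1)) = U(1)ᵈ` of the lattice. -/
abbrev BrillouinTorus (d : ℕ) : Type := Fin d → Circle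

/-- The value of the character `lam` at the lattice point `n`. -/
noncomputable def character {d : ℕ} (lam : BrillouinTorus d) (n : Fin d → ℤ) : Circle :=
  ∏ i, lam i ^ n i

/-- The universal covering `k ↦ exp(2πi⟨k, -⟩)` of the Brillouin torus by momentum space. -/
noncomputable def torusExp {d : ℕ} (k : Space d) : BrillouinTorus d :=
  fun i => Circle.exp (2 * Real.pi * k i)

/-- The fundamental cell `[0,1)ᵈ` of the lattice. -/
def unitCell (d : ℕ) : Set (Space d) := {x | ∀ i, 0 ≤ x i ∧ x i < 1}

section Bundles

variable {d : ℕ} {W : Type*} [NormedAddCommGroup W] [NormedSpace ℝ W]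

/-- Smooth maps on the torus `ℝᵈ/ℤᵈ`. -/
def IsSmooth (f : BrillouinTorus d → W) : Prop :=
  ContDiff ℝ ((⊤ : ℕ∞) : WithTop ℕ∞) (fun k : Space d => f (torusExp k))

/-- The derivative of `f` at `lam` in the direction `v`; every tangent space of the torus `ℝᵈ/ℤᵈ`
is `ℝᵈ`. -/
noncomputable def dirDeriv (v : Space d) (f : BrillouinTorus d → W) (lam : BrillouinTorus d) : W :=
  deriv (fun t : ℝ => f (lam * torusExp (t • v))) 0

variable {F : Type*} [NormedAddCommGroup F] [InnerProductSpace ℂ F]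

/-- The integral over the Brillouin torus with respect to the normalised Haar measure. -/
noncomputable def torusIntegral (s : BrillouinTorus d → F) : F :=
  ∫ k in unitCell d, s (torusExp k)

/-- The covariant derivative of the parallel transport `P`, where `P k` is the transport from any
point `lam` to `lam exp(2πik)` along paths whose lifts to `ℝᵈ` have total increment `k`:
`(D v s)(lam)` is the derivative at `t = 0` of `P(t v)⁻¹ s(lam exp(2πitv))`. -/
noncomputable def transportDeriv (P : Space d → F → F) :
    Space d → (BrillouinTorus d → F) → BrillouinTorus d → F :=
  fun v s lam => deriv (fun t : ℝ => P (-(t • v)) (s (lam * torusExp (t • v)))) 0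

/-- `K` is a smooth Hermitian vector bundle of finite rank over the Brillouin torus, given as a
subbundle of the trivial Hilbert bundle with fibre `F`: near every point there is a smooth frame. -/
def IsSmoothSubbundle (K : BrillouinTorus d → Submodule ℂ F) : Prop :=
  ∀ k₀ : Space d, ∃ U ∈ 𝓝 k₀, ∃ (n : ℕ) (s : Fin n → Space d → F),
    (∀ i, ContDiffOn ℝ ((⊤ : ℕ∞) : WithTop ℕ∞) (s i) U) ∧
    ∀ k ∈ U, LinearIndependent ℂ (fun i => s i k) ∧
      Submodule.span ℂ (Set.range fun i => s i k) = K (torusExp k)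

/-- The smooth sections of `K`. -/
structure IsSection (K : BrillouinTorus d → Submodule ℂ F) (s : BrillouinTorus d → F) : Prop where
  smooth : IsSmooth s
  mem : ∀ lam, s lam ∈ K lam

/-- `D` is a connection on `K`: `D v s` is the covariant derivative of the section `s` along the
invariant vector field `v`. (Only the values on smooth sections of `K` are relevant.) -/
structure IsConnection (K : BrillouinTorus d → Submodule ℂ F)
    (D : Space d → (BrillouinTorus d → F) → BrillouinTorus d → F) : Prop where
  isSection : ∀ v s, IsSection K s → IsSection K (D v s)
  linear_left : ∀ (c : ℝ) v w s, IsSection K s → D (c • v + w) s = (c : ℂ) • D v s + D w s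
  linear_right : ∀ v (a : ℂ) s t, IsSection K s → IsSection K t →
    D v (a • s + t) = a • D v s + D v t
  leibniz : ∀ v s (f : BrillouinTorus d → ℂ), IsSection K s → IsSmooth f →
    ∀ lam, D v (fun m => f m • s m) lam = dirDeriv v f lam • s lam + f lam • D v s lam

/-- Hermitian connections: those for which the fibre metric is parallel. -/
structure IsHermitianConnection (K : BrillouinTorus d → Submodule ℂ F)
    (D : Space d → (BrillouinTorus d → F) → BrillouinTorus d → F) : Prop
    extends IsConnection K D where
  metric : ∀ v s t, IsSection K s → IsSection K t → ∀ lam,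
    dirDeriv v (fun m => ⟪s m, t m⟫_ℂ) lam = ⟪D v s lam, t lam⟫_ℂ + ⟪s lam, D v t lam⟫_ℂ

/-- The action on sections of a lift `τ lam : K_{lam⁻¹} → K_{lam}` of the inversion. -/
noncomputable def liftSection (τ : BrillouinTorus d → F → F) (s : BrillouinTorus d → F) :
    BrillouinTorus d → F :=
  fun lam => τ lam (s lam⁻¹)

/-- `τ` is a smooth antiunitary lift to `K` of the inversion `lam ↦ lam⁻¹` of the Brillouin torus,
that is, a unitary isomorphism from the complex conjugate of the pullback of `K` to `K`. -/
structure IsAntiunitaryLift (K : BrillouinTorus d → Submodule ℂ F)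
    (τ : BrillouinTorus d → F → F) : Prop where
  bijOn : ∀ lam, Set.BijOn (τ lam) (K lam⁻¹) (K lam)
  antilinear : ∀ lam (a : ℂ), ∀ f ∈ K lam⁻¹, ∀ g ∈ K lam⁻¹,
    τ lam (a • f + g) = conj a • τ lam f + τ lam g
  inner : ∀ lam, ∀ f ∈ K lam⁻¹, ∀ g ∈ K lam⁻¹, ⟪τ lam f, τ lam g⟫_ℂ = conj ⟪f, g⟫_ℂ
  smooth : ∀ s, IsSection K s → IsSmooth (liftSection τ s)

/-- `(K, τ)` is a Hermitian vector bundle of finite rank with an antiunitary lift `τ` of the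
inversion that squares to `ε`. -/
structure IsSignedBundle (ε : ℤˣ) (K : BrillouinTorus d → Submodule ℂ F)
    (τ : BrillouinTorus d → F → F) : Prop extends IsAntiunitaryLift K τ where
  bundle : IsSmoothSubbundle K
  sq : ∀ lam, ∀ f ∈ K lam, τ lam (τ lam⁻¹ f) = ((ε : ℤ) : ℂ) • f

/-- Real vector bundles over the Brillouin torus with inversion. -/
abbrev IsRealBundle (K : BrillouinTorus d → Submodule ℂ F) (τ : BrillouinTorus d → F → F) : Prop :=
  IsSignedBundle 1 K τ

/-- Quaternionic vector bundles over the Brillouin torus with inversion. -/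
abbrev IsQuaternionicBundle (K : BrillouinTorus d → Submodule ℂ F)
    (τ : BrillouinTorus d → F → F) : Prop :=
  IsSignedBundle (-1) K τ

/-- The lift `τ` of the inversion preserves the connection `D`; the differential of the inversion
is `v ↦ -v`. -/
def PreservesConnection (K : BrillouinTorus d → Submodule ℂ F) (τ : BrillouinTorus d → F → F)
    (D : Space d → (BrillouinTorus d → F) → BrillouinTorus d → F) : Prop :=
  ∀ v s, IsSection K s → D v (liftSection τ s) = liftSection τ (D (-v) s)

/-- The average of `D` over `ℤ₂`: the mean of `D` and of its transform under the lift `τ`, where `τ`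
squares to `ε` and hence has inverse `ε τ`. -/
noncomputable def averageConnection (ε : ℤˣ) (τ : BrillouinTorus d → F → F)
    (D : Space d → (BrillouinTorus d → F) → BrillouinTorus d → F) :
    Space d → (BrillouinTorus d → F) → BrillouinTorus d → F :=
  fun v s => (1 / 2 : ℂ) • (D v s + liftSection τ (D (-v) (((ε : ℤ) : ℂ) • liftSection τ s)))

end Bundles

/-! ### Wavefunctions and the Bloch decomposition -/

section Wavefunctions

variable {d : ℕ} {V : Type*} [NormedAddCommGroup V] [InnerProductSpace ℂ V]

variable (d V) in
/-- The Hilbert space `L²(ℝᵈ, V)`. -/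
abbrev Wavefunction : Type _ := Lp V 2 (volume : Measure (Space d))

variable (d V) in
/-- The fibre `E_lam` of the Hilbert bundle `E` over the Brillouin torus. It consists of the
functions `ψ` on `ℝᵈ` with values in `V`, square-integrable on the fundamental cell, which are
quasiperiodic, `ψ(x - n) = lam(n) ψ(x)` for `n ∈ ℤᵈ`; equivalently, of the square-integrable
sections over `ℝᵈ/ℤᵈ` of `V` tensored with the Poincaré line bundle at `lam`. Such a function is
determined by its restriction to the fundamental cell, which can be an arbitrary element of
`L²([0,1)ᵈ, V)`, and this restriction is what we record. It is a unitary and smooth trivialisation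
of `E`: relative to the local trivialisations of `E` by the flat frames `exp(-2πi⟨k, x⟩)` it is
multiplication by a function of `x` in the (bounded) cell, smooth in `k` in operator norm. -/
abbrev BlochFibre : Type _ := Lp V 2 ((volume : Measure (Space d)).restrict (unitCell d))

/-- The restriction of the function `x ↦ ψ(x + n)` to the fundamental cell. -/
noncomputable def cellPiece (n : Fin d → ℤ) (ψ : Wavefunction d V) : BlochFibre d V :=
  (((Lp.memLp ψ).comp_measurePreserving
    (measurePreserving_add_right volume (latticeVec n))).restrict (unitCell d)).toLp _

/-- `s` is the image of `ψ` under the unitary isomorphism `U` from `L²(ℝᵈ, V)` to the Hilbert space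
of `L²`-sections of `E`, i.e. `s` is square-integrable and `ψ(x) = ∫ s(lam)(x) dlam` for the
normalised Haar measure. For `x = y + n` with `y` in the cell, `s(lam)(x) = lam(n)⁻¹ s(lam)(y)`. -/
def IsBlochTransform (ψ : Wavefunction d V) (s : BrillouinTorus d → BlochFibre d V) : Prop :=
  MemLp (fun k : Space d => s (torusExp k)) 2 (volume.restrict (unitCell d)) ∧
  ∀ n : Fin d → ℤ, cellPiece n ψ =
    torusIntegral fun lam => (((character lam n)⁻¹ : Circle) : ℂ) • s lam

/-- Multiplication by the phase `exp(-2πi⟨k, x - x₀⟩)`: the parallel transport of `E`, from any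
`lam` to `lam exp(2πik)`, along a path in the torus whose lifts to `ℝᵈ` have total increment `k`. -/
noncomputable def blochTransport (x₀ k : Space d) (f : BlochFibre d V) : BlochFibre d V :=
  MemLp.toLp (fun x : Space d =>
      Complex.exp (-(2 * Real.pi * Complex.I * (⟪k, x - x₀⟫_ℝ : ℝ))) • f x) (by
    refine (Lp.memLp f).of_le
      (AEStronglyMeasurable.smul (Continuous.aestronglyMeasurable (by fun_prop))
        (Lp.memLp f).1) (Filter.Eventually.of_forall fun x => ?_)
    rw [norm_smul, Complex.norm_exp]
    simp)

/-- The covariant derivative on `E` with parallel transport `blochTransport`. -/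
noncomputable def blochConnection (x₀ : Space d) :
    Space d → (BrillouinTorus d → BlochFibre d V) → BrillouinTorus d → BlochFibre d V :=
  transportDeriv (blochTransport x₀)

end Wavefunctions

/-- A band insulator with wavefunctions in `L²(ℝᵈ, V)` on the lattice `ℤᵈ`, with symmetry class
`ℤᵈ × (ℤ₂)_qu`, where `Q = (ℤ₂)_qu` is a quantum extension of the group `ℤ₂ = {1, -1}` generated by
an antiunitary time reversal that commutes with the Hamiltonian and acts trivially on space. -/
structure BandInsulator (d : ℕ) (V : Type*) [NormedAddCommGroup V] [InnerProductSpace ℂ V]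
    [CompleteSpace V] {Q : Type*} [Group Q] [TopologicalSpace Q]
    (e : QuantumExtension ℤˣ Q (MonoidHom.id ℤˣ)) where
  /-- the action of the symmetry group on wavefunctions -/
  ρ : Multiplicative (Fin d → ℤ) × Q →* Equiv.Perm (Wavefunction d V)
  continuous_ρ : ∀ ψ, Continuous fun g => ρ g ψ
  unitary : ∀ g, e.q g.2 = 1 → IsUnitaryMap (ρ g)
  antiunitary : ∀ g, e.q g.2 = -1 → IsAntiunitaryMap (ρ g)
  scalar : ∀ (u : Circle) ψ, ρ (1, e.ι u) ψ = (u : ℂ) • ψ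
  /-- lattice vectors act by translation -/
  translation : ∀ (n : Fin d → ℤ) ψ,
    ρ (Multiplicative.ofAdd n, 1) ψ =ᵐ[volume] fun x => ψ (x - latticeVec n)
  /-- `(ℤ₂)_qu` acts on wavefunctions over the identity map of space -/
  isLocal : ∀ (g : Q) (S : Set (Space d)), MeasurableSet S → ∀ ψ : Wavefunction d V,
    (∀ᵐ x, x ∈ S → ψ x = 0) → ∀ᵐ x, x ∈ S → ρ (1, g) ψ x = 0
  /-- the Hamiltonian -/
  ham : Wavefunction d V →ₗ.[ℂ] Wavefunction d V
  dense_ham : Dense (ham.domain : Set (Wavefunction d V))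
  selfAdjoint_ham : IsSelfAdjoint ham
  gapped_ham : ∃ B, IsBoundedInverse ham B
  symmetric : ∀ g ψ χ, (ψ, χ) ∈ ham.graph → (ρ g ψ, ρ g χ) ∈ ham.graph
  /-- the Bloch Hamiltonians on the fibres of `E` -/
  blochHam : BrillouinTorus d → BlochFibre d V →ₗ.[ℂ] BlochFibre d V
  dense_blochHam : ∀ lam, Dense ((blochHam lam).domain : Set (BlochFibre d V))
  selfAdjoint_blochHam : ∀ lam, IsSelfAdjoint (blochHam lam)
  /-- The Hamiltonian is the direct integral of the Bloch Hamiltonians. -/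
  decomposition : ∀ ψ χ s t, IsBlochTransform ψ s → IsBlochTransform χ t →
    ((ψ, χ) ∈ ham.graph ↔ ∀ᵐ k ∂(volume.restrict (unitCell d)),
      (s (torusExp k), t (torusExp k)) ∈ (blochHam (torusExp k)).graph)
  /-- The Bloch Hamiltonians are gapped and form a continuous family, in the norm resolvent sense. -/
  continuous_blochHam : ∃ R : BrillouinTorus d → BlochFibre d V →L[ℂ] BlochFibre d V,
    Continuous R ∧ ∀ lam, IsBoundedInverse (blochHam lam) (R lam)
  /-- The negative spectral projections have finite rank. -/
  finite_negative : ∀ lam, FiniteDimensional ℂ (negativeEigenspace (blochHam lam))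
  /-- On the orthogonal complement of the negative eigenspaces there is no negative spectrum. -/
  nonneg : ∀ lam f g, (f, g) ∈ (blochHam lam).graph → f ∈ (negativeEigenspace (blochHam lam))ᗮ →
    0 ≤ (⟪f, g⟫_ℂ).re
  /-- The negative spectral subspaces form a smooth subbundle of `E`. -/
  smooth_negative : IsSmoothSubbundle fun lam => negativeEigenspace (blochHam lam)

namespace BandInsulator

variable {d : ℕ} {V : Type*} [NormedAddCommGroup V] [InnerProductSpace ℂ V]
  [CompleteSpace V] {Q : Type*} [Group Q] [TopologicalSpace Q]
  {e : QuantumExtension ℤˣ Q (MonoidHom.id ℤˣ)}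

/-- The Bloch bundle `E⁻`. -/
noncomputable def blochBundle (B : BandInsulator d V e) (lam : BrillouinTorus d) : Submodule ℂ (BlochFibre d V) :=
  negativeEigenspace (B.blochHam lam)

instance (B : BandInsulator d V e) (lam : BrillouinTorus d) :
    FiniteDimensional ℂ (B.blochBundle lam) :=
  B.finite_negative lam

/-- The Berry connection: the compression to `E⁻` of the connection of `E`. -/
noncomputable def berryConnection (B : BandInsulator d V e) (x₀ : Space d) :
    Space d → (BrillouinTorus d → BlochFibre d V) → BrillouinTorus d → BlochFibre d V :=
  fun v s lam => (B.blochBundle lam).starProjection (blochConnection x₀ v s lam)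

/-- `τ` is the action on `E` of the element `T` of `(ℤ₂)_qu` above `-1`: it is a smooth antiunitary
lift of the inversion to the whole Hilbert bundle `E`, and it corresponds to the action of `T` on
wavefunctions under the isomorphism of `L²(ℝᵈ, V)` with the `L²`-sections of `E`. -/
structure IsFibreAction (B : BandInsulator d V e) (T : Q)
    (τ : BrillouinTorus d → BlochFibre d V → BlochFibre d V) : Prop where
  lift : IsAntiunitaryLift (fun _ => ⊤) τ
  equivariant : ∀ ψ s, IsBlochTransform ψ s → IsBlochTransform (B.ρ (1, T) ψ) (liftSection τ s)

end BandInsulator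

end BlochTheory

/-! Cut `ℝᵈ` into translates of the unit cell. A lift `T` of time reversal acts over the identity of
space and commutes with translations, so it acts in every cell by one and the same antiunitary map
`J` of `L²` of the cell (`cellPiece_ρ`). The cell pieces of a wavefunction are the Fourier
coefficients of its Bloch transform. Antilinearity conjugates the characters, so on sections `T`
becomes `s ↦ J (s lam⁻¹)` (`isBlochTransform_of_cellPiece`). In the trivialisation by the cell the
lift is therefore constant in `lam`, and smoothness is automatic.

The square of `J` is the scalar `u` with `T * T = ι u`. Since `T * T` commutes with `T` while `T`
inverts phases, `u = ±1`; the sign does not depend on the lift, and it is `1` exactly when the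
extension splits.

That the Hamiltonian commutes with `T` gives equivariance of the Bloch Hamiltonians only for almost
every `lam`. Norm continuity of their inverses makes it hold for all `lam` (`inverse_fibreMap`). As
eigenvalues are real, `J` then carries negative eigenvectors at `lam⁻¹` to negative eigenvectors at
`lam`.

In the same trivialisation the connection of `E` is `d + M`, where `M v` is multiplication by
`2πi⟨v, x - x₀⟩`: bounded because the cell is, and skew-adjoint because the function is imaginary.
Hence its compression to `E⁻` is Hermitian. A local antiunitary map conjugates multiplication
operators (`IsLocalMap.map_mul`), so `J` intertwines `M (-v)` with `M v` and preserves the Berry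
connection, whatever the sign. Averaging an arbitrary connection is formal; the average of the Berry
connection is Hermitian because it is the Berry connection itself. -/

namespace BlochTheory

/-! ### The Brillouin torus: covering by momenta, Haar integral, characters -/

section Torus

variable {d : ℕ}

theorem torusExp_add (k l : Space d) : torusExp (k + l) = torusExp k * torusExp l := by
  funext i
  simp [torusExp, mul_add, Circle.exp_add]

theorem torusExp_zero : torusExp (0 : Space d) = 1 := by
  funext i
  simp [torusExp]

theorem torusExp_neg (k : Space d) : torusExp (-k) = (torusExp k)⁻¹ := by
  funext i
  simp [torusExp, Circle.exp_neg]

theorem continuous_torusExp : Continuous (torusExp : Space d → BrillouinTorus d) := by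
  unfold torusExp
  fun_prop

theorem exists_mem_unitCell_torusExp (lam : BrillouinTorus d) :
    ∃ k ∈ unitCell d, torusExp k = lam := by
  have h : ∀ i, ∃ t : ℝ, Circle.exp t = lam i := fun i => ⟨_, Circle.exp_arg (lam i)⟩
  choose t ht using h
  refine ⟨WithLp.toLp 2 fun i => Int.fract (t i / (2 * Real.pi)), fun i =>
    ⟨Int.fract_nonneg _, Int.fract_lt_one _⟩, ?_⟩
  funext i
  have h2 : 2 * Real.pi * Int.fract (t i / (2 * Real.pi)) =
      t i - ⌊t i / (2 * Real.pi)⌋ * (2 * Real.pi) := by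
    rw [Int.fract]
    field_simp
  simp only [torusExp, h2, ← ht i]
  rw [Circle.exp_sub, Circle.exp_int_mul_two_pi, div_one]

theorem torusExp_surjective : Function.Surjective (torusExp : Space d → BrillouinTorus d) :=
  fun lam => (exists_mem_unitCell_torusExp lam).imp fun _ h => h.2

theorem unitCell_eq_preimage :
    unitCell d = WithLp.ofLp ⁻¹' (Set.univ.pi fun _ : Fin d => Set.Ico (0 : ℝ) 1) := by
  ext x
  simp [unitCell]

theorem measurableSet_unitCell : MeasurableSet (unitCell d) := by
  rw [unitCell_eq_preimage]
  exact (MeasurableSet.univ_pi fun _ => measurableSet_Ico).preimage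
    (PiLp.volume_preserving_ofLp (Fin d)).measurable

theorem measurePreserving_ofLp_unitCell :
    MeasurePreserving (WithLp.ofLp : Space d → Fin d → ℝ) (volume.restrict (unitCell d))
      (Measure.pi fun _ : Fin d => (volume : Measure ℝ).restrict (Set.Ico 0 1)) := by
  rw [unitCell_eq_preimage, ← Measure.restrict_pi_pi, ← volume_pi]
  exact (PiLp.volume_preserving_ofLp (Fin d)).restrict_preimage
    (MeasurableSet.univ_pi fun _ => measurableSet_Ico)

theorem volume_unitCell : volume (unitCell d) = 1 := by
  have h := (measurePreserving_ofLp_unitCell (d := d)).measure_preimage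
    MeasurableSet.univ.nullMeasurableSet
  simpa [Measure.pi_univ] using h

instance : IsProbabilityMeasure ((volume : Measure (Space d)).restrict (unitCell d)) :=
  ⟨by simp [volume_unitCell]⟩

theorem unitCell_subset_closure_interior : unitCell d ⊆ closure (interior (unitCell d)) := by
  rw [unitCell_eq_preimage]
  let e := (PiLp.homeomorph 2 fun _ : Fin d => ℝ)
  change e ⁻¹' _ ⊆ closure (interior (e ⁻¹' _))
  rw [← e.preimage_interior, ← e.preimage_closure, interior_pi_set Set.finite_univ, closure_pi_set]
  refine Set.preimage_mono (Set.pi_mono fun i _ => ?_)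
  simp only [interior_Ico]
  rw [closure_Ioo (by norm_num)]
  exact Set.Ico_subset_Icc_self

/-- The reflection `x ↦ (1, …, 1) - x` of the unit cell. -/
noncomputable def cellReflection (d : ℕ) (x : Space d) : Space d := WithLp.toLp 2 (fun _ => 1) - x

theorem torusExp_cellReflection (k : Space d) : torusExp (cellReflection d k) = (torusExp k)⁻¹ := by
  rw [cellReflection, sub_eq_add_neg, torusExp_add, torusExp_neg]
  have : torusExp (WithLp.toLp 2 (fun _ => 1) : Space d) = 1 := by
    funext i
    simp [torusExp]
  rw [this, one_mul]

/-- The half-open cell and its reflection differ only where some coordinate is 0 or 1, a null set.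
-/
theorem cellReflection_preimage_unitCell :
    cellReflection d ⁻¹' unitCell d =ᵐ[volume] unitCell d := by
  have h : ∀ i : Fin d, ∀ c : ℝ, ∀ᵐ x : Space d, x i ≠ c := by
    intro i c
    have h1 : ∀ᵐ x : Fin d → ℝ, x i ≠ c := by
      rw [volume_pi]
      exact Measure.ae_eval_ne (α := fun _ : Fin d => ℝ) _ i c
    exact (PiLp.volume_preserving_ofLp (Fin d)).quasiMeasurePreserving.ae h1
  filter_upwards [ae_all_iff.2 fun i => h i 0, ae_all_iff.2 fun i => h i 1] with x h0 h1
  refine propext ?_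
  change (∀ i, 0 ≤ 1 - x i ∧ 1 - x i < 1) ↔ ∀ i, 0 ≤ x i ∧ x i < 1
  refine forall_congr' fun i => ?_
  have := (h0 i).lt_or_gt
  have := (h1 i).lt_or_gt
  grind

theorem measurePreserving_cellReflection :
    MeasurePreserving (cellReflection d) (volume.restrict (unitCell d))
      (volume.restrict (unitCell d)) := by
  have h := ((volume : Measure (Space d)).measurePreserving_sub_left
    (WithLp.toLp 2 (fun _ => 1))).restrict_preimage (measurableSet_unitCell (d := d))
  change MeasurePreserving (cellReflection d) (volume.restrict (cellReflection d ⁻¹' _)) _ at h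
  rwa [Measure.restrict_congr_set cellReflection_preimage_unitCell] at h

theorem measurableEmbedding_cellReflection : MeasurableEmbedding (cellReflection d) :=
  (MeasurableEquiv.subLeft (WithLp.toLp 2 (fun _ => 1) : Space d)).measurableEmbedding

theorem torusIntegral_inv {F : Type*} [NormedAddCommGroup F] [InnerProductSpace ℂ F]
    (s : BrillouinTorus d → F) : torusIntegral (fun lam => s lam⁻¹) = torusIntegral s := by
  unfold torusIntegral
  rw [← measurePreserving_cellReflection.integral_comp measurableEmbedding_cellReflection]
  simp [torusExp_cellReflection]

/-- The cell lies in the closure of its interior, so continuous functions agreeing almost everywhere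
on it agree on all of it. This turns direct-integral statements into statements at every `lam`. -/
theorem eq_of_ae_eq_unitCell {F : Type*} [TopologicalSpace F] [T2Space F]
    {f g : BrillouinTorus d → F}
    (hf : Continuous f) (hg : Continuous g)
    (h : ∀ᵐ k ∂(volume.restrict (unitCell d)), f (torusExp k) = g (torusExp k)) : f = g := by
  funext lam
  obtain ⟨k, hk, rfl⟩ := exists_mem_unitCell_torusExp lam
  exact Measure.eqOn_of_ae_eq h (hf.comp continuous_torusExp).continuousOn
    (hg.comp continuous_torusExp).continuousOn unitCell_subset_closure_interior hk

theorem character_mul (lam : BrillouinTorus d) (m n : Fin d → ℤ) :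
    character lam (m + n) = character lam m * character lam n := by
  simp [character, zpow_add, Finset.prod_mul_distrib]

theorem character_neg (lam : BrillouinTorus d) (n : Fin d → ℤ) :
    character lam (-n) = (character lam n)⁻¹ := by
  simp [character]

theorem character_inv (lam : BrillouinTorus d) (n : Fin d → ℤ) :
    character lam⁻¹ n = (character lam n)⁻¹ := by
  simp [character]

theorem continuous_character (n : Fin d → ℤ) :
    Continuous fun lam : BrillouinTorus d => character lam n := by
  unfold character
  fun_prop

/-- The integral factorises over the coordinates, and a nontrivial exponential integrates to zero
over a full period. -/
theorem integral_character (n : Fin d → ℤ) :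
    ∫ k in unitCell d, (character (torusExp k) n : ℂ) = if n = 0 then 1 else 0 := by
  have h1 : ∀ k : Space d, (character (torusExp k) n : ℂ) =
      ∏ i, (fun t : ℝ => Complex.exp ((2 * Real.pi * Complex.I * n i) * t)) (k.ofLp i) := by
    intro k
    refine (map_prod Circle.coeHom _ _).trans ?_
    refine Finset.prod_congr rfl fun i _ => ?_
    change ((Circle.exp (2 * Real.pi * k i) ^ n i : Circle) : ℂ) = _
    rw [Circle.coe_zpow, Circle.coe_exp, ← Complex.exp_int_mul]
    congr 1
    push_cast
    ring
  simp_rw [h1]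
  rw [measurePreserving_ofLp_unitCell.integral_comp
    (MeasurableEquiv.toLp 2 (Fin d → ℝ)).symm.measurableEmbedding
    (fun x => ∏ i, (fun t : ℝ => Complex.exp ((2 * Real.pi * Complex.I * n i) * t)) (x i))]
  rw [integral_fintype_prod_eq_prod
    (f := fun i (t : ℝ) => Complex.exp ((2 * Real.pi * Complex.I * n i) * t))]
  have h2 : ∀ i, ∫ t : ℝ in Set.Ico 0 1, Complex.exp ((2 * Real.pi * Complex.I * n i) * t) =
      if n i = 0 then 1 else 0 := by
    intro i
    rw [integral_Ico_eq_integral_Ioc, ← intervalIntegral.integral_of_le zero_le_one]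
    split_ifs with h
    · simp [h]
    · rw [integral_exp_mul_complex (by simp [h])]
      have : (2 * Real.pi * Complex.I * n i) * ((1 : ℝ) : ℂ) = n i * (2 * Real.pi * Complex.I) := by
        push_cast
        ring
      rw [this, Complex.exp_int_mul_two_pi_mul_I]
      simp
  simp_rw [h2]
  by_cases hn : n = 0
  · simp [hn]
  · obtain ⟨i, hi⟩ := Function.ne_iff.1 hn
    rw [if_neg hn]
    exact Finset.prod_eq_zero (Finset.mem_univ i) (if_neg hi)

end Torus

/-- Bessel's inequality, from `0 ≤ ‖y - x‖²` with `y = ∑ J i (c i)`. The coefficient `c i` plays the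
role of the adjoint of `J i` applied to `x`. -/
theorem OrthogonalFamily.sum_norm_sq_le {ι E F : Type*} [NormedAddCommGroup E]
    [InnerProductSpace ℂ E] [NormedAddCommGroup F] [InnerProductSpace ℂ F] {J : ι → F →ₗᵢ[ℂ] E}
    (hJ : OrthogonalFamily ℂ (fun _ => F) J) {x : E} {c : ι → F}
    (hc : ∀ i v, ⟪J i v, x⟫_ℂ = ⟪v, c i⟫_ℂ) (S : Finset ι) : ∑ i ∈ S, ‖c i‖ ^ 2 ≤ ‖x‖ ^ 2 := by
  set y := ∑ i ∈ S, J i (c i) with hy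
  have h1 : ‖y‖ ^ 2 = ∑ i ∈ S, ‖c i‖ ^ 2 := hJ.norm_sum c S
  have h2 : RCLike.re ⟪y, x⟫_ℂ = ∑ i ∈ S, ‖c i‖ ^ 2 := by
    rw [hy, sum_inner, map_sum]
    exact Finset.sum_congr rfl fun i _ => by rw [hc, inner_self_eq_norm_sq]
  have h3 := norm_sub_sq (𝕜 := ℂ) y x
  nlinarith [sq_nonneg ‖y - x‖]

/-! ### Decomposition of wavefunctions into cell pieces -/

section Lattice

variable {d : ℕ}

theorem latticeVec_add (m n : Fin d → ℤ) :
    (latticeVec (m + n) : Space d) = latticeVec m + latticeVec n := by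
  ext i
  simp [latticeVec]

theorem latticeVec_neg (n : Fin d → ℤ) : (latticeVec (-n) : Space d) = -latticeVec n := by
  ext i
  simp [latticeVec]

theorem add_latticeVec_notMem_unitCell {n : Fin d → ℤ} (hn : n ≠ 0) {x : Space d}
    (hx : x ∈ unitCell d) : x + latticeVec n ∉ unitCell d := by
  obtain ⟨i, hi⟩ := Function.ne_iff.1 hn
  intro h
  have h1 := hx i
  have h2 := h i
  simp only [latticeVec, PiLp.add_apply] at h2
  have h3 : (n i : ℝ) < 1 := by linarith
  have h4 : (-1 : ℝ) < n i := by linarith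
  have h5 : n i < 1 := by exact_mod_cast h3
  have h6 : -1 < n i := by exact_mod_cast h4
  exact hi (by simp only [Pi.zero_apply]; omega)

end Lattice

section Wavefunctions

variable {d : ℕ} {V : Type*} [NormedAddCommGroup V] [InnerProductSpace ℂ V]

/-- The translate `x ↦ ψ(x + n)` of a wavefunction. -/
noncomputable def shift (n : Fin d → ℤ) : Wavefunction d V →ₗᵢ[ℂ] Wavefunction d V :=
  Lp.compMeasurePreservingₗᵢ ℂ _ (measurePreserving_add_right volume (latticeVec n))

theorem coeFn_shift (n : Fin d → ℤ) (ψ : Wavefunction d V) :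
    shift n ψ =ᵐ[volume] fun x => ψ (x + latticeVec n) :=
  Lp.coeFn_compMeasurePreserving ψ (measurePreserving_add_right volume (latticeVec n))

theorem shift_shift (m n : Fin d → ℤ) (ψ : Wavefunction d V) :
    shift m (shift n ψ) = shift (m + n) ψ := by
  refine Lp.ext ?_
  filter_upwards [coeFn_shift m (shift n ψ), coeFn_shift (m + n) ψ,
    (measurePreserving_add_right volume (latticeVec m)).quasiMeasurePreserving.ae
      (coeFn_shift n ψ)] with x h1 h2 h3
  rw [h1, h2, h3, latticeVec_add, add_assoc]

theorem shift_zero (ψ : Wavefunction d V) : shift 0 ψ = ψ := by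
  refine Lp.ext ?_
  filter_upwards [coeFn_shift 0 ψ] with x h
  rw [h]
  congr 1
  ext i
  simp [latticeVec]

theorem inner_shift_left (n : Fin d → ℤ) (ψ χ : Wavefunction d V) :
    ⟪shift n ψ, χ⟫_ℂ = ⟪ψ, shift (-n) χ⟫_ℂ := by
  rw [← (shift (-n)).inner_map_map, shift_shift, neg_add_cancel, shift_zero]

variable (d V) in
/-- Restriction of wavefunctions to the unit cell. -/
noncomputable def cellRestrict : Wavefunction d V →L[ℂ] BlochFibre d V :=
  LpToLpRestrictCLM (Space d) V ℂ volume 2 (unitCell d)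

theorem coeFn_cellRestrict (ψ : Wavefunction d V) :
    cellRestrict d V ψ =ᵐ[volume.restrict (unitCell d)] ψ :=
  LpToLpRestrictCLM_coeFn ℂ _ ψ

theorem cellPiece_eq (n : Fin d → ℤ) (ψ : Wavefunction d V) :
    cellPiece n ψ = cellRestrict d V (shift n ψ) := by
  refine Lp.ext ?_
  filter_upwards [coeFn_cellRestrict (shift n ψ), ae_restrict_of_ae (coeFn_shift n ψ),
    MemLp.coeFn_toLp (((Lp.memLp ψ).comp_measurePreserving
    (measurePreserving_add_right volume (latticeVec n))).restrict (unitCell d))] with x h1 h2 h3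
  rw [h1, h2]
  exact h3

omit [InnerProductSpace ℂ V] in
theorem memLp_indicator_unitCell (f : BlochFibre d V) :
    MemLp ((unitCell d).indicator f) 2 volume :=
  (memLp_indicator_iff_restrict measurableSet_unitCell).2 (Lp.memLp f)

omit [InnerProductSpace ℂ V] in
theorem indicator_unitCell_ae_eq {f g : Space d → V} (h : f =ᵐ[volume.restrict (unitCell d)] g) :
    (unitCell d).indicator f =ᵐ[volume] (unitCell d).indicator g := by
  filter_upwards [(ae_restrict_iff' measurableSet_unitCell).1 h] with x hx
  by_cases hc : x ∈ unitCell d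
  · simp [hc, hx hc]
  · simp [hc]

variable (d V) in
/-- Extension by zero from the unit cell. -/
noncomputable def extendZero : BlochFibre d V →ₗᵢ[ℂ] Wavefunction d V where
  toFun f := (memLp_indicator_unitCell f).toLp _
  map_add' f g := by
    rw [← MemLp.toLp_add, MemLp.toLp_eq_toLp_iff, ← Set.indicator_add']
    exact indicator_unitCell_ae_eq (Lp.coeFn_add f g)
  map_smul' c f := by
    rw [RingHom.id_apply, ← MemLp.toLp_const_smul, MemLp.toLp_eq_toLp_iff]
    refine (indicator_unitCell_ae_eq (Lp.coeFn_smul c f)).trans (Filter.EventuallyEq.of_eq ?_)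
    exact Set.indicator_const_smul (unitCell d) c f
  norm_map' f := by
    change ‖(memLp_indicator_unitCell f).toLp _‖ = ‖f‖
    rw [Lp.norm_toLp, eLpNorm_indicator_eq_eLpNorm_restrict measurableSet_unitCell, Lp.norm_def]

theorem coeFn_extendZero (f : BlochFibre d V) :
    extendZero d V f =ᵐ[volume] (unitCell d).indicator f :=
  MemLp.coeFn_toLp (memLp_indicator_unitCell f)

theorem cellRestrict_extendZero (f : BlochFibre d V) :
    cellRestrict d V (extendZero d V f) = f := by
  refine Lp.ext ?_
  filter_upwards [coeFn_cellRestrict (extendZero d V f), ae_restrict_of_ae (coeFn_extendZero f),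
    ae_restrict_mem measurableSet_unitCell] with x h1 h2 h3
  rw [h1, h2, Set.indicator_of_mem h3]

theorem cellRestrict_eq_zero {ψ : Wavefunction d V} (h : ∀ᵐ x, x ∈ unitCell d → ψ x = 0) :
    cellRestrict d V ψ = 0 := by
  refine Lp.ext ?_
  filter_upwards [coeFn_cellRestrict ψ, ae_restrict_of_ae h,
    ae_restrict_mem measurableSet_unitCell, Lp.coeFn_zero V 2 (volume.restrict (unitCell d))]
    with x h1 h2 h3 h4
  rw [h1, h4, h2 h3, Pi.zero_apply]

theorem extendZero_cellRestrict {ψ : Wavefunction d V} (h : ∀ᵐ x, x ∈ (unitCell d)ᶜ → ψ x = 0) :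
    extendZero d V (cellRestrict d V ψ) = ψ := by
  refine Lp.ext ?_
  filter_upwards [coeFn_extendZero (cellRestrict d V ψ), h,
    (ae_restrict_iff' measurableSet_unitCell).1 (coeFn_cellRestrict ψ)] with x h1 h2 h3
  rw [h1]
  by_cases hx : x ∈ unitCell d
  · rw [Set.indicator_of_mem hx, h3 hx]
  · rw [Set.indicator_of_notMem hx, h2 hx]

theorem inner_extendZero_left (f : BlochFibre d V) (ψ : Wavefunction d V) :
    ⟪extendZero d V f, ψ⟫_ℂ = ⟪f, cellRestrict d V ψ⟫_ℂ := by
  rw [L2.inner_def, L2.inner_def]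
  have h1 : ∫ x, ⟪extendZero d V f x, ψ x⟫_ℂ =
      ∫ x, (unitCell d).indicator (fun x => ⟪f x, ψ x⟫_ℂ) x := by
    refine integral_congr_ae ?_
    filter_upwards [coeFn_extendZero f] with x h
    rw [h]
    by_cases hx : x ∈ unitCell d <;> simp [hx]
  rw [h1, integral_indicator measurableSet_unitCell]
  refine integral_congr_ae ?_
  filter_upwards [coeFn_cellRestrict ψ] with x h
  rw [h]

/-- Distinct lattice translates of the cell are disjoint. -/
theorem cellPiece_shift_extendZero (n m : Fin d → ℤ) (f : BlochFibre d V) :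
    cellPiece n (shift (-m) (extendZero d V f)) = if n = m then f else 0 := by
  rw [cellPiece_eq, shift_shift]
  split_ifs with h
  · rw [h, add_neg_cancel, shift_zero, cellRestrict_extendZero]
  · refine cellRestrict_eq_zero ?_
    have h0 : n + -m ≠ 0 := by rwa [← sub_eq_add_neg, sub_ne_zero]
    filter_upwards [coeFn_shift (n + -m) (extendZero d V f),
      (measurePreserving_add_right volume (latticeVec (n + -m))).quasiMeasurePreserving.ae
        (coeFn_extendZero f)] with x h1 h2 hx
    rw [h1, h2, Set.indicator_of_notMem (add_latticeVec_notMem_unitCell h0 hx)]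

variable (d V) in
theorem orthogonalFamily_shift_extendZero :
    OrthogonalFamily ℂ (fun _ : Fin d → ℤ => BlochFibre d V)
      fun n => (shift (-n)).comp (extendZero d V) := by
  intro m n hmn f g
  simp only [LinearIsometry.coe_comp, Function.comp_apply]
  rw [inner_shift_left, inner_extendZero_left, ← cellPiece_eq, neg_neg,
    cellPiece_shift_extendZero, if_neg hmn, inner_zero_right]

/-- Square-summable cell pieces glue to a wavefunction. -/
theorem exists_cellPiece_eq [CompleteSpace V] {c : (Fin d → ℤ) → BlochFibre d V}
    (hc : Summable fun n => ‖c n‖ ^ 2) : ∃ ψ : Wavefunction d V, ∀ n, cellPiece n ψ = c n := by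
  have hs := ((orthogonalFamily_shift_extendZero d V).summable_iff_norm_sq_summable c).2 hc
  refine ⟨∑' n, ((shift (-n)).comp (extendZero d V)) (c n), fun n => ?_⟩
  rw [cellPiece_eq]
  -- Taking the `n`-th cell piece is continuous and linear, so it may be applied term by term; it
  -- kills every term but the `n`-th.
  have h := hs.hasSum.mapL ((cellRestrict d V).comp (shift n).toContinuousLinearMap)
  refine h.unique ?_
  convert hasSum_ite_eq n (c n) using 2 with m
  have h1 := cellPiece_shift_extendZero n m (c m)
  rw [cellPiece_eq] at h1
  simp only [ContinuousLinearMap.comp_apply, LinearIsometry.coe_toContinuousLinearMap,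
    LinearIsometry.coe_comp, Function.comp_apply, h1]
  by_cases hmn : n = m
  · simp [hmn]
  · simp [hmn, Ne.symm hmn]

/-- A continuous section of the Hilbert bundle is the transform of a wavefunction. -/
theorem exists_isBlochTransform [CompleteSpace V] {s : BrillouinTorus d → BlochFibre d V}
    (hs : Continuous s) : ∃ ψ : Wavefunction d V, IsBlochTransform ψ s := by
  obtain ⟨C, hC⟩ := (isCompact_range hs).isBounded.exists_norm_le
  have hbd : ∀ lam, ‖s lam‖ ≤ C := fun lam => hC _ ⟨lam, rfl⟩
  have key : ∀ {f : BrillouinTorus d → BlochFibre d V}, Continuous f → (∀ lam, ‖f lam‖ ≤ C) →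
      MemLp (fun k : Space d => f (torusExp k)) 2 (volume.restrict (unitCell d)) := by
    intro f hf hb
    exact MemLp.of_bound (hf.comp continuous_torusExp).aestronglyMeasurable C
      (Filter.Eventually.of_forall fun k => hb _)
  have hm : ∀ (n : Fin d → ℤ) (v : BlochFibre d V), MemLp
      (fun k : Space d => (character (torusExp k) n : ℂ) • v) 2 (volume.restrict (unitCell d)) := by
    intro n v
    refine MemLp.of_bound (Continuous.aestronglyMeasurable ?_) ‖v‖
      (Filter.Eventually.of_forall fun k => by
        rw [norm_smul, Circle.norm_coe, one_mul])
    exact (continuous_subtype_val.comp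
      ((continuous_character n).comp continuous_torusExp)).smul continuous_const
  -- The `n`-th Fourier mode with coefficient `v`. These embeddings are isometric because the cell
  -- has volume 1, and mutually orthogonal by `integral_character`.
  let J : (Fin d → ℤ) → BlochFibre d V →ₗᵢ[ℂ]
      Lp (BlochFibre d V) 2 ((volume : Measure (Space d)).restrict (unitCell d)) := fun n =>
    { toFun := fun v => (hm n v).toLp _
      map_add' := fun v w => by
        rw [← MemLp.toLp_add]
        congr 1
        funext k
        simp
      map_smul' := fun a v => by
        rw [RingHom.id_apply, ← MemLp.toLp_const_smul]
        congr 1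
        funext k
        simp [smul_comm a]
      norm_map' := fun v => by
        have h : eLpNorm (fun k : Space d => (character (torusExp k) n : ℂ) • v) 2
            (volume.restrict (unitCell d)) = eLpNorm (fun _ : Space d => v) 2
            (volume.restrict (unitCell d)) :=
          eLpNorm_congr_norm_ae (Filter.Eventually.of_forall fun k => by
            rw [norm_smul, Circle.norm_coe, one_mul])
        simp [Lp.norm_toLp, h, eLpNorm_const, NeZero.ne] }
  have hJ : ∀ n v, J n v =ᵐ[volume.restrict (unitCell d)]
      fun k : Space d => (character (torusExp k) n : ℂ) • v := fun n v => (hm n v).coeFn_toLp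
  have hJo : OrthogonalFamily ℂ (fun _ => BlochFibre d V) J := by
    intro m n hmn v w
    have h : ∫ k in unitCell d, ⟪J m v k, J n w k⟫_ℂ =
        ∫ k in unitCell d, (character (torusExp k) (n - m) : ℂ) * ⟪v, w⟫_ℂ := by
      refine integral_congr_ae ?_
      filter_upwards [hJ m v, hJ n w] with k h1 h2
      rw [h1, h2, inner_smul_left, inner_smul_right, sub_eq_add_neg, character_mul,
        character_neg, Circle.coe_mul, Circle.coe_inv_eq_conj]
      ring
    rw [L2.inner_def, h, integral_mul_const, integral_character,
      if_neg (sub_ne_zero.2 (Ne.symm hmn)), zero_mul]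
  -- The Fourier coefficients of `s`, prescribed as cell pieces. Bessel's inequality makes them
  -- square-summable, so they glue; completeness of the characters is not needed.
  let c : (Fin d → ℤ) → BlochFibre d V := fun n =>
    torusIntegral fun lam => (((character lam n)⁻¹ : Circle) : ℂ) • s lam
  have hsm := key hs hbd
  have hc : ∀ n v, ⟪J n v, hsm.toLp _⟫_ℂ = ⟪v, c n⟫_ℂ := by
    intro n v
    have hint : Integrable (fun k : Space d =>
        (((character (torusExp k) n)⁻¹ : Circle) : ℂ) • s (torusExp k))
        (volume.restrict (unitCell d)) := by
      refine (key (f := fun lam => (((character lam n)⁻¹ : Circle) : ℂ) • s lam) ?_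
        fun lam => ?_).integrable one_le_two
      · exact (continuous_subtype_val.comp (continuous_character n).inv).smul hs
      · rw [norm_smul, Circle.norm_coe, one_mul]
        exact hbd lam
    rw [L2.inner_def]
    refine Eq.trans ?_ (integral_inner hint v)
    refine integral_congr_ae ?_
    filter_upwards [hJ n v, hsm.coeFn_toLp] with k h1 h2
    rw [h1, h2, inner_smul_left, inner_smul_right, Circle.coe_inv_eq_conj]
  obtain ⟨ψ, hψ⟩ := exists_cellPiece_eq (c := c)
    (summable_of_sum_le (fun n => sq_nonneg _) fun S => OrthogonalFamily.sum_norm_sq_le hJo hc S)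
  exact ⟨ψ, hsm, hψ⟩

end Wavefunctions

/-! ### The sign of a quantum extension of `ℤ₂` -/

section QuantumExtension

variable {Q : Type*} [Group Q] [TopologicalSpace Q]
  {e : QuantumExtension ℤˣ Q (MonoidHom.id ℤˣ)}

/-- Moving `T` past a phase inverts it, so the two phases cancel: all lifts of `-1` have the same
square. -/
theorem QuantumExtension.ι_mul_self (e : QuantumExtension ℤˣ Q (MonoidHom.id ℤˣ)) {T : Q}
    (hT : e.q T = -1) (u : Circle) : (e.ι u * T) * (e.ι u * T) = T * T := by
  have h := e.twist T u
  rw [MonoidHom.id_apply, hT] at h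
  have h1 : e.ι u * T * (e.ι u * T) = e.ι u * (T * e.ι u) * T := by group
  rw [h1, h]
  simp

theorem QuantumExtension.exists_ι_mul (e : QuantumExtension ℤˣ Q (MonoidHom.id ℤˣ)) {S T : Q}
    (h : e.q S = e.q T) : ∃ u, T = e.ι u * S := by
  have h1 : T * S⁻¹ ∈ e.q.ker := by simp [MonoidHom.mem_ker, h]
  rw [← e.exact] at h1
  obtain ⟨u, hu⟩ := h1
  exact ⟨u, by simp [hu]⟩

/-- The splitting provides one lift of `-1` with square 1, and all lifts have the same square. -/
theorem QuantumExtension.IsTrivial.mul_self (he : e.IsTrivial) {T : Q} (hT : e.q T = -1) :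
    T * T = 1 := by
  obtain ⟨s, -, hs⟩ := he
  have h1 : e.q (s (-1)) = -1 := hs (-1)
  obtain ⟨u, rfl⟩ := e.exists_ι_mul (h1.trans hT.symm)
  rw [e.ι_mul_self h1, ← map_mul]
  simp

theorem QuantumExtension.isTrivial_of_mul_self {T : Q} (hT : e.q T = -1) (h : T * T = 1) :
    e.IsTrivial := by
  refine ⟨{ toFun := fun g => if g = 1 then 1 else T, map_one' := if_pos rfl, map_mul' := ?_ },
    ?_, ?_⟩
  · intro a b
    rcases Int.units_eq_one_or a with rfl | rfl <;> rcases Int.units_eq_one_or b with rfl | rfl <;>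
      simp [h]
  · exact continuous_of_discreteTopology
  · intro g
    rcases Int.units_eq_one_or g with rfl | rfl
    · simp
    · simpa using hT

/-- Write `T * T = ι u`. It commutes with `T`, whereas the twist inverts `u`, so `u = u⁻¹` and `u =
±1`. The value 1 would give a splitting. -/
theorem QuantumExtension.mul_self_of_not_isTrivial (he : ¬ e.IsTrivial) {T : Q}
    (hT : e.q T = -1) : T * T = e.ι (-1) := by
  have h1 : e.q (1 : Q) = e.q (T * T) := by simp [hT]
  obtain ⟨u, hu⟩ := e.exists_ι_mul h1
  rw [mul_one] at hu
  have h2 := e.twist T u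
  rw [MonoidHom.id_apply, hT, ← hu, ← mul_assoc, mul_left_inj, hu] at h2
  have h3 : u = u⁻¹ := by simpa using e.isEmbedding_ι.injective h2
  have h4 : (u : ℂ) * u = 1 := by
    rw [← Circle.coe_mul]
    nth_rewrite 1 [h3]
    simp
  rcases mul_self_eq_one_iff.1 h4 with h | h
  · exact absurd (isTrivial_of_mul_self hT (by rw [hu, Circle.coe_eq_one.1 h, map_one])) he
  · rw [hu]
    congr 1
    exact Circle.ext (by simpa using h)

end QuantumExtension

/-! ### Local antilinear isometries of `L²` -/

section LocalIsometry

variable {X V : Type*} [MeasurableSpace X] {μ : Measure X} [NormedAddCommGroup V]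
  [InnerProductSpace ℂ V]

/-- An operator on `L²` is local when it does not increase essential supports. -/
def IsLocalMap (J : Lp V 2 μ → Lp V 2 μ) : Prop :=
  ∀ S : Set X, MeasurableSet S → ∀ f : Lp V 2 μ, (∀ᵐ x ∂μ, x ∈ S → f x = 0) →
    ∀ᵐ x ∂μ, x ∈ S → J f x = 0

/-- Split `f` into its parts on `S` and on the complement. Locality keeps the images supported
there, so `∫_S ‖J f‖²` is the squared norm of the image of the first part, and isometry makes it
`∫_S ‖f‖²`. As `S` is arbitrary, the densities agree. -/
theorem IsLocalMap.norm_ae_eq {J : Lp V 2 μ →ₗᵢ⋆[ℂ] Lp V 2 μ} (hJ : IsLocalMap J)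
    (f : Lp V 2 μ) : ∀ᵐ x ∂μ, ‖J f x‖ = ‖f x‖ := by
  have hint : ∀ g : Lp V 2 μ, Integrable (fun x => ‖g x‖ ^ 2) μ := fun g =>
    (memLp_two_iff_integrable_sq_norm (Lp.memLp g).1).1 (Lp.memLp g)
  have hnorm : ∀ g : Lp V 2 μ, ∫ x, ‖g x‖ ^ 2 ∂μ = ‖g‖ ^ 2 := by
    intro g
    rw [← inner_self_eq_norm_sq (𝕜 := ℂ), L2.inner_def, ← integral_re (L2.integrable_inner g g)]
    simp_rw [inner_self_eq_norm_sq]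
  have key : (fun x => ‖J f x‖ ^ 2) =ᵐ[μ] fun x => ‖f x‖ ^ 2 := by
    refine Integrable.ae_eq_of_forall_setIntegral_eq _ _ (hint _) (hint _) fun S hS _ => ?_
    have hm1 := (Lp.memLp f).indicator hS
    have hm2 := (Lp.memLp f).indicator hS.compl
    set f₁ := hm1.toLp _
    set f₂ := hm2.toLp _
    have h1 : f₁ =ᵐ[μ] S.indicator f := hm1.coeFn_toLp
    have h2 : f₂ =ᵐ[μ] Sᶜ.indicator f := hm2.coeFn_toLp
    have hsum : f = f₁ + f₂ := by
      refine Lp.ext ?_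
      filter_upwards [h1, h2, Lp.coeFn_add f₁ f₂] with x hx1 hx2 hx3
      rw [hx3, Pi.add_apply, hx1, hx2]
      by_cases hx : x ∈ S <;> simp [hx]
    have l1 : ∀ᵐ x ∂μ, x ∈ Sᶜ → J f₁ x = 0 := by
      refine hJ _ hS.compl _ ?_
      filter_upwards [h1] with x hx hxS
      rw [hx, Set.indicator_of_notMem hxS]
    have l2 : ∀ᵐ x ∂μ, x ∈ S → J f₂ x = 0 := by
      refine hJ _ hS _ ?_
      filter_upwards [h2] with x hx hxS
      rw [hx, Set.indicator_of_notMem (by simpa using hxS)]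
    have e1 : ∫ x in S, ‖J f x‖ ^ 2 ∂μ = ‖J f₁‖ ^ 2 := by
      rw [← hnorm, ← integral_indicator hS]
      refine integral_congr_ae ?_
      have hJsum : J f = J f₁ + J f₂ := by rw [← map_add, ← hsum]
      rw [hJsum]
      filter_upwards [l1, l2, Lp.coeFn_add (J f₁) (J f₂)] with x hx1 hx2 hx3
      by_cases hx : x ∈ S
      · rw [Set.indicator_of_mem hx, hx3, Pi.add_apply, hx2 hx, add_zero]
      · simp [hx, hx1 hx]
    have e2 : ∫ x in S, ‖f x‖ ^ 2 ∂μ = ‖f₁‖ ^ 2 := by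
      rw [← hnorm, ← integral_indicator hS]
      refine integral_congr_ae ?_
      filter_upwards [h1] with x hx1
      by_cases hx : x ∈ S <;> simp [hx, hx1]
    rw [e1, e2, J.norm_map]
  filter_upwards [key] with x hx
  exact (sq_eq_sq₀ (norm_nonneg _) (norm_nonneg _)).1 hx

/-- Pointwise norms are preserved for `g - c • f`, whose value at `x` is `(φ x - c) • f x`. Once
this is known at `x` for every constant `c`, choosing `c = φ x` makes the norm vanish. -/
theorem IsLocalMap.map_mul {J : Lp V 2 μ →ₗᵢ⋆[ℂ] Lp V 2 μ} (hJ : IsLocalMap J)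
    {f g : Lp V 2 μ} {φ : X → ℂ} (h : g =ᵐ[μ] fun x => φ x • f x) :
    J g =ᵐ[μ] fun x => conj (φ x) • J f x := by
  have h1 : ∀ c : ℂ, ∀ᵐ x ∂μ, ‖J g x - conj c • J f x‖ = ‖(φ x - c) • f x‖ := by
    intro c
    have h2 : J (g - c • f) = J g - conj c • J f := by rw [map_sub, map_smulₛₗ]
    have h3 := hJ.norm_ae_eq (g - c • f)
    rw [h2] at h3
    filter_upwards [h, h3, Lp.coeFn_sub g (c • f), Lp.coeFn_smul c f,
      Lp.coeFn_sub (J g) (conj c • J f), Lp.coeFn_smul (conj c) (J f)] with x a1 a2 a3 a4 a5 a6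
    rw [a3, a5, Pi.sub_apply, Pi.sub_apply, a4, a6, Pi.smul_apply, Pi.smul_apply, a1] at a2
    rw [a2, sub_smul]
  -- Only countably many exceptional null sets may be discarded; a dense sequence of `c` suffices
  -- because both norms are continuous in `c`.
  filter_upwards [ae_all_iff.2 fun n => h1 (TopologicalSpace.denseSeq ℂ n)] with x hx
  have h4 : (fun c : ℂ => ‖J g x - conj c • J f x‖) = fun c => ‖(φ x - c) • f x‖ := by
    refine Continuous.ext_on (TopologicalSpace.denseRange_denseSeq ℂ) (by fun_prop) (by fun_prop) ?_
    rintro _ ⟨n, rfl⟩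
    exact hx n
  have h5 := congrFun h4 (φ x)
  simpa [sub_eq_zero] using h5

end LocalIsometry

/-! ### Time reversal on the fibres -/

namespace BandInsulator

variable {d : ℕ} {V : Type*} [NormedAddCommGroup V] [InnerProductSpace ℂ V]
  [CompleteSpace V] {Q : Type*} [Group Q] [TopologicalSpace Q]
  {e : QuantumExtension ℤˣ Q (MonoidHom.id ℤˣ)}

theorem ρ_lattice (B : BandInsulator d V e) (n : Fin d → ℤ) (ψ : Wavefunction d V) :
    B.ρ (Multiplicative.ofAdd n, 1) ψ = shift (-n) ψ := by
  refine Lp.ext ?_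
  filter_upwards [B.translation n ψ, coeFn_shift (-n) ψ] with x h1 h2
  rw [h1, h2, latticeVec_neg, sub_eq_add_neg]

theorem ρ_shift (B : BandInsulator d V e) (g : Q) (n : Fin d → ℤ) (ψ : Wavefunction d V) :
    B.ρ (1, g) (shift n ψ) = shift n (B.ρ (1, g) ψ) := by
  have h := fun χ => (ρ_lattice B (-n) χ).symm
  simp only [neg_neg] at h
  rw [h, h, ← Equiv.Perm.mul_apply, ← Equiv.Perm.mul_apply, ← map_mul, ← map_mul]
  simp

/-- The difference of `ψ` and its truncation vanishes on the cell, and by locality so does its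
image. -/
theorem cellRestrict_ρ (B : BandInsulator d V e) {T : Q} (hT : e.q T = -1)
    (ψ : Wavefunction d V) :
    cellRestrict d V (B.ρ (1, T) ψ) =
      cellRestrict d V (B.ρ (1, T) (extendZero d V (cellRestrict d V ψ))) := by
  have hanti := B.antiunitary (1, T) hT
  set χ := extendZero d V (cellRestrict d V ψ) with hχ
  have h1 : B.ρ (1, T) ψ = B.ρ (1, T) (ψ - χ) + B.ρ (1, T) χ := by
    have := hanti.antilinear 1 (ψ - χ) χ
    simpa using this
  have h2 : cellRestrict d V (B.ρ (1, T) (ψ - χ)) = 0 := by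
    refine cellRestrict_eq_zero (B.isLocal T _ measurableSet_unitCell _ ?_)
    filter_upwards [Lp.coeFn_sub ψ χ, coeFn_extendZero (cellRestrict d V ψ),
      (ae_restrict_iff' measurableSet_unitCell).1 (coeFn_cellRestrict ψ)] with x a1 a2 a3 hx
    rw [a1, Pi.sub_apply, hχ, a2, Set.indicator_of_mem hx, a3 hx, sub_self]
  rw [h1, map_add, h2, zero_add]

theorem extendZero_cellRestrict_ρ (B : BandInsulator d V e) (T : Q) (f : BlochFibre d V) :
    extendZero d V (cellRestrict d V (B.ρ (1, T) (extendZero d V f))) =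
      B.ρ (1, T) (extendZero d V f) := by
  refine extendZero_cellRestrict (B.isLocal T _ measurableSet_unitCell.compl _ ?_)
  filter_upwards [coeFn_extendZero f] with x h hx
  rw [h, Set.indicator_of_notMem hx]

/-- The action on the fibres of `E` of an element of `(ℤ₂)_qu` above `-1`. -/
noncomputable def fibreMap (B : BandInsulator d V e) (T : Q) (hT : e.q T = -1) :
    BlochFibre d V →ₗᵢ⋆[ℂ] BlochFibre d V where
  toFun f := cellRestrict d V (B.ρ (1, T) (extendZero d V f))
  map_add' f g := by
    have h := (B.antiunitary (1, T) hT).antilinear 1 (extendZero d V f) (extendZero d V g)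
    rw [one_smul, map_one, one_smul] at h
    rw [map_add, h, map_add]
  map_smul' a f := by
    have h0 := (B.antiunitary (1, T) hT).antilinear 1 0 0
    rw [one_smul, map_one, one_smul, add_zero, left_eq_add] at h0
    have h := (B.antiunitary (1, T) hT).antilinear a (extendZero d V f) 0
    rw [add_zero, h0, add_zero] at h
    rw [map_smul, h, map_smul]
  norm_map' f := by
    change ‖cellRestrict d V (B.ρ (1, T) (extendZero d V f))‖ = ‖f‖
    rw [← (extendZero d V).norm_map, extendZero_cellRestrict_ρ, ← (extendZero d V).norm_map f]
    have h := (B.antiunitary (1, T) hT).inner (extendZero d V f) (extendZero d V f)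
    rw [inner_self_eq_norm_sq_to_K, inner_self_eq_norm_sq_to_K, ← map_pow,
      ← map_pow, RCLike.conj_ofReal] at h
    exact (sq_eq_sq₀ (norm_nonneg _) (norm_nonneg _)).1 (RCLike.ofReal_injective h)

variable (B : BandInsulator d V e) {T : Q} (hT : e.q T = -1)

theorem extendZero_fibreMap (f : BlochFibre d V) :
    extendZero d V (B.fibreMap T hT f) = B.ρ (1, T) (extendZero d V f) :=
  B.extendZero_cellRestrict_ρ T f

/-- Commutation with translations moves the `n`-th cell to the origin, where locality applies; hence
the same map serves all `n`. -/
theorem cellPiece_ρ (n : Fin d → ℤ) (ψ : Wavefunction d V) :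
    cellPiece n (B.ρ (1, T) ψ) = B.fibreMap T hT (cellPiece n ψ) := by
  rw [cellPiece_eq, cellPiece_eq, ← ρ_shift, B.cellRestrict_ρ hT]
  rfl

theorem inner_fibreMap (f g : BlochFibre d V) :
    ⟪B.fibreMap T hT f, B.fibreMap T hT g⟫_ℂ = conj ⟪f, g⟫_ℂ := by
  rw [← (extendZero d V).inner_map_map, extendZero_fibreMap, extendZero_fibreMap,
    (B.antiunitary (1, T) hT).inner, (extendZero d V).inner_map_map]

/-- Extension by zero intertwines the fibre map with `ρ (1, T)`, so the square can be computed in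
the symmetry group. -/
theorem fibreMap_fibreMap {u : Circle} (hu : T * T = e.ι u) (f : BlochFibre d V) :
    B.fibreMap T hT (B.fibreMap T hT f) = (u : ℂ) • f := by
  refine (extendZero d V).injective ?_
  rw [extendZero_fibreMap, extendZero_fibreMap, map_smul, ← B.scalar, ← Equiv.Perm.mul_apply,
    ← map_mul, Prod.mk_mul_mk, hu, one_mul]

theorem isLocalMap_fibreMap : IsLocalMap (B.fibreMap T hT) := by
  intro S hS f hf
  have h1 : ∀ᵐ x, x ∈ S → extendZero d V f x = 0 := by
    filter_upwards [coeFn_extendZero f, (ae_restrict_iff' measurableSet_unitCell).1 hf]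
      with x a1 a2 hx
    rw [a1]
    by_cases hc : x ∈ unitCell d
    · rw [Set.indicator_of_mem hc, a2 hc hx]
    · rw [Set.indicator_of_notMem hc]
  filter_upwards [ae_restrict_of_ae (B.isLocal T S hS _ h1),
    coeFn_cellRestrict (B.ρ (1, T) (extendZero d V f))] with x a1 a2 hx
  exact a2.trans (a1 hx)

end BandInsulator

/-- A conjugate-linear isometry as a continuous real-linear map. -/
noncomputable def conjIsometryToRealCLM {F : Type*} [NormedAddCommGroup F] [InnerProductSpace ℂ F]
    (J : F →ₗᵢ⋆[ℂ] F) : F →L[ℝ] F :=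
  (J.toLinearMap.toAddMonoidHom).toRealLinearMap J.continuous

theorem torusIntegral_conjIsometry {d : ℕ} {F : Type*} [NormedAddCommGroup F]
    [InnerProductSpace ℂ F] [CompleteSpace F] (J : F →ₗᵢ⋆[ℂ] F) {s : BrillouinTorus d → F}
    (hs : Integrable (fun k : Space d => s (torusExp k)) (volume.restrict (unitCell d))) :
    torusIntegral (fun lam => J (s lam)) = J (torusIntegral s) :=
  (conjIsometryToRealCLM J).integral_comp_comm hs

/-- Pulled through the Fourier integral, the antilinear `J` turns `lam(n)⁻¹` into `lam(n)`; the
substitution `lam ↦ lam⁻¹` restores the kernel and moves the inversion into the section. This is why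
an antilinear symmetry trivial on space reverses momentum. -/
theorem isBlochTransform_of_cellPiece {d : ℕ} {V : Type*} [NormedAddCommGroup V]
    [InnerProductSpace ℂ V] [CompleteSpace V] (J : BlochFibre d V →ₗᵢ⋆[ℂ] BlochFibre d V)
    {ψ χ : Wavefunction d V} (h : ∀ n, cellPiece n χ = J (cellPiece n ψ))
    {s : BrillouinTorus d → BlochFibre d V} (hs : IsBlochTransform ψ s) :
    IsBlochTransform χ (liftSection (fun _ => J) s) := by
  constructor
  · have h1 := hs.1.comp_measurePreserving measurePreserving_cellReflection
    refine h1.of_le (f := fun k => J (s (torusExp k)⁻¹)) ?_ ?_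
    · refine J.continuous.comp_aestronglyMeasurable (f := fun k => s (torusExp k)⁻¹) ?_
      simpa [Function.comp_def, torusExp_cellReflection] using h1.1
    · refine Filter.Eventually.of_forall fun k => ?_
      rw [J.norm_map, Function.comp_apply, torusExp_cellReflection]
  · intro n
    have hint : Integrable (fun k : Space d =>
        (((character (torusExp k) n)⁻¹ : Circle) : ℂ) • s (torusExp k))
        (volume.restrict (unitCell d)) := by
      refine (hs.1.integrable one_le_two).bdd_smul 1 (Continuous.aestronglyMeasurable ?_)
        (Filter.Eventually.of_forall fun k => (Circle.norm_coe _).le)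
      exact continuous_subtype_val.comp ((continuous_character n).comp continuous_torusExp).inv
    rw [h n, hs.2 n, ← torusIntegral_conjIsometry (s := fun lam =>
        (((character lam n)⁻¹ : Circle) : ℂ) • s lam) J hint, ← torusIntegral_inv]
    congr 1
    funext lam
    rw [map_smulₛₗ, character_inv, inv_inv, liftSection, ← Circle.coe_inv_eq_conj]

/-! ### Calculus on the torus -/

section Smooth

variable {d : ℕ} {W W' : Type*} [NormedAddCommGroup W] [NormedSpace ℝ W]
  [NormedAddCommGroup W'] [NormedSpace ℝ W']

theorem IsSmooth.continuousLinearMap_comp {f : BrillouinTorus d → W} (hf : IsSmooth f)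
    (L : W →L[ℝ] W') : IsSmooth fun lam => L (f lam) :=
  L.contDiff.comp hf

theorem IsSmooth.comp_inv {f : BrillouinTorus d → W} (hf : IsSmooth f) :
    IsSmooth fun lam => f lam⁻¹ := by
  unfold IsSmooth
  simp_rw [← torusExp_neg]
  exact ContDiff.comp (g := fun k : Space d => f (torusExp k)) hf contDiff_neg

theorem IsSmooth.hasDerivAt_add {f : BrillouinTorus d → W} (hf : IsSmooth f) (k v : Space d) :
    HasDerivAt (fun t : ℝ => f (torusExp k * torusExp (t • v)))
      (fderiv ℝ (fun l : Space d => f (torusExp l)) k v) 0 := by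
  have h1 : HasDerivAt (fun t : ℝ => k + t • v) v 0 := by
    simpa using ((hasDerivAt_id (0 : ℝ)).smul_const v).const_add k
  have h2 : HasFDerivAt (fun l : Space d => f (torusExp l))
      (fderiv ℝ (fun l : Space d => f (torusExp l)) k) (k + (0 : ℝ) • v) := by
    rw [zero_smul, add_zero]
    exact (ContDiff.differentiable hf (by simp) k).hasFDerivAt
  have h3 := h2.comp_hasDerivAt 0 h1
  simpa [Function.comp_def, torusExp_add] using h3

/-- On the covering the directional derivative becomes a Fréchet derivative, which yields linearity
in `v` and smoothness in the point. -/
theorem IsSmooth.dirDeriv_torusExp {f : BrillouinTorus d → W} (hf : IsSmooth f) (k v : Space d) :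
    dirDeriv v f (torusExp k) = fderiv ℝ (fun l : Space d => f (torusExp l)) k v :=
  (hf.hasDerivAt_add k v).deriv

theorem IsSmooth.hasDerivAt {f : BrillouinTorus d → W} (hf : IsSmooth f) (v : Space d)
    (lam : BrillouinTorus d) :
    HasDerivAt (fun t : ℝ => f (lam * torusExp (t • v))) (dirDeriv v f lam) 0 := by
  obtain ⟨k, rfl⟩ := torusExp_surjective lam
  rw [hf.dirDeriv_torusExp]
  exact hf.hasDerivAt_add k v

theorem IsSmooth.dirDeriv {f : BrillouinTorus d → W} (hf : IsSmooth f) (v : Space d) :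
    IsSmooth (dirDeriv v f) := by
  unfold IsSmooth
  simp_rw [hf.dirDeriv_torusExp]
  exact (ContDiff.fderiv_right (m := ((⊤ : ℕ∞) : WithTop ℕ∞)) hf le_rfl).clm_apply contDiff_const

theorem IsSmooth.dirDeriv_smul_add {f : BrillouinTorus d → W} (hf : IsSmooth f) (c : ℝ)
    (v w : Space d) (lam : BrillouinTorus d) :
    BlochTheory.dirDeriv (c • v + w) f lam =
      c • BlochTheory.dirDeriv v f lam + BlochTheory.dirDeriv w f lam := by
  obtain ⟨k, rfl⟩ := torusExp_surjective lam
  simp_rw [hf.dirDeriv_torusExp]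
  rw [map_add, map_smul]

theorem IsSmooth.dirDeriv_continuousLinearMap_inv {f : BrillouinTorus d → W} (hf : IsSmooth f)
    (L : W →L[ℝ] W') (v : Space d) (lam : BrillouinTorus d) :
    BlochTheory.dirDeriv v (fun m => L (f m⁻¹)) lam =
      L (BlochTheory.dirDeriv (-v) f lam⁻¹) := by
  refine HasDerivAt.deriv ?_
  have h := L.hasFDerivAt.comp_hasDerivAt (0 : ℝ) (hf.hasDerivAt (-v) lam⁻¹)
  convert h using 3 with t
  change L (f (lam * torusExp (t • v))⁻¹) = L (f (lam⁻¹ * torusExp (t • -v)))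
  rw [mul_inv, ← torusExp_neg, smul_neg]

theorem mul_torusExp_zero_smul (lam : BrillouinTorus d) (v : Space d) :
    lam * torusExp ((0 : ℝ) • v) = lam := by
  rw [zero_smul, torusExp_zero, mul_one]

end Smooth

/-! ### Sections, smooth projections and compressed connections -/

section Bundles

variable {d : ℕ} {F : Type*} [NormedAddCommGroup F] [InnerProductSpace ℂ F]

theorem IsSmooth.smul {f : BrillouinTorus d → ℂ} {s : BrillouinTorus d → F} (hf : IsSmooth f)
    (hs : IsSmooth s) : IsSmooth fun lam => f lam • s lam :=
  ContDiff.smul hf hs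

theorem IsSection.smul_add {K : BrillouinTorus d → Submodule ℂ F} {s t : BrillouinTorus d → F}
    (a : ℂ) (hs : IsSection K s) (ht : IsSection K t) : IsSection K (a • s + t) :=
  ⟨ContDiff.add (ContDiff.const_smul a hs.smooth) ht.smooth,
    fun lam => (K lam).add_mem ((K lam).smul_mem a (hs.mem lam)) (ht.mem lam)⟩

theorem IsSection.zero (K : BrillouinTorus d → Submodule ℂ F) : IsSection K 0 :=
  ⟨contDiff_const, fun lam => (K lam).zero_mem⟩

theorem IsSection.const_smul {K : BrillouinTorus d → Submodule ℂ F} {s : BrillouinTorus d → F}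
    (a : ℂ) (hs : IsSection K s) : IsSection K (a • s) := by
  simpa using hs.smul_add a (IsSection.zero K)

theorem IsSection.add {K : BrillouinTorus d → Submodule ℂ F} {s t : BrillouinTorus d → F}
    (hs : IsSection K s) (ht : IsSection K t) : IsSection K (s + t) := by
  simpa using hs.smul_add 1 ht

theorem IsSection.smul {K : BrillouinTorus d → Submodule ℂ F} {s : BrillouinTorus d → F}
    {f : BrillouinTorus d → ℂ} (hf : IsSmooth f) (hs : IsSection K s) :
    IsSection K fun lam => f lam • s lam :=
  ⟨hf.smul hs.smooth, fun lam => (K lam).smul_mem _ (hs.mem lam)⟩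

theorem IsSection.dirDeriv_smul {K : BrillouinTorus d → Submodule ℂ F} {s : BrillouinTorus d → F}
    {f : BrillouinTorus d → ℂ} (hf : IsSmooth f) (hs : IsSection K s) (v : Space d)
    (lam : BrillouinTorus d) :
    dirDeriv v (fun m => f m • s m) lam = dirDeriv v f lam • s lam + f lam • dirDeriv v s lam := by
  refine HasDerivAt.deriv ?_
  have h := (hf.hasDerivAt v lam).smul (hs.smooth.hasDerivAt v lam)
  simp only [mul_torusExp_zero_smul] at h
  rw [add_comm]
  exact h

theorem dirDeriv_smul_add {s t : BrillouinTorus d → F} (hs : IsSmooth s) (ht : IsSmooth t)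
    (a : ℂ) (v : Space d) (lam : BrillouinTorus d) :
    dirDeriv v (a • s + t) lam = a • dirDeriv v s lam + dirDeriv v t lam :=
  HasDerivAt.deriv (((hs.hasDerivAt v lam).const_smul a).add (ht.hasDerivAt v lam))

theorem dirDeriv_inner {s t : BrillouinTorus d → F} (hs : IsSmooth s) (ht : IsSmooth t)
    (v : Space d) (lam : BrillouinTorus d) :
    dirDeriv v (fun m => ⟪s m, t m⟫_ℂ) lam =
      ⟪dirDeriv v s lam, t lam⟫_ℂ + ⟪s lam, dirDeriv v t lam⟫_ℂ := by
  refine HasDerivAt.deriv ?_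
  have h := (hs.hasDerivAt v lam).inner ℂ (ht.hasDerivAt v lam)
  simp only [mul_torusExp_zero_smul] at h
  rw [add_comm]
  exact h

section Projection

/-- Induction along the recursion; linear independence keeps the denominators nonzero. -/
theorem contDiffOn_gramSchmidt {n : ℕ} {s : Fin n → Space d → F} {U : Set (Space d)}
    (hs : ∀ i, ContDiffOn ℝ ((⊤ : ℕ∞) : WithTop ℕ∞) (s i) U)
    (hli : ∀ k ∈ U, LinearIndependent ℂ (fun i => s i k)) (i : Fin n) :
    ContDiffOn ℝ ((⊤ : ℕ∞) : WithTop ℕ∞)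
      (fun k => InnerProductSpace.gramSchmidt ℂ (fun j => s j k) i) U := by
  induction i using WellFoundedLT.induction with
  | ind i ih =>
    simp_rw [InnerProductSpace.gramSchmidt_def ℂ _ i]
    refine (hs i).sub (ContDiffOn.sum fun j hj => ?_)
    have hj' := ih j (Finset.mem_Iio.1 hj)
    simp_rw [Submodule.starProjection_singleton]
    refine ContDiffOn.smul ?_ hj'
    simp_rw [div_eq_mul_inv]
    refine (hj'.inner ℂ (hs i)).mul (ContDiffOn.inv ?_ fun k hk => ?_)
    · exact Complex.ofRealCLM.contDiff.comp_contDiffOn (hj'.norm_sq ℂ)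
    · have := InnerProductSpace.gramSchmidt_ne_zero (𝕜 := ℂ) j (hli k hk)
      simpa using this

theorem starProjection_eq_sum_gramSchmidt {n : ℕ} {s : Fin n → F} {K : Submodule ℂ F}
    [K.HasOrthogonalProjection] (hK : Submodule.span ℂ (Set.range s) = K) (u : F) :
    K.starProjection u = ∑ i, (⟪InnerProductSpace.gramSchmidt ℂ s i, u⟫_ℂ /
      ((‖InnerProductSpace.gramSchmidt ℂ s i‖ ^ 2 : ℝ) : ℂ)) •
      InnerProductSpace.gramSchmidt ℂ s i := by
  set g := InnerProductSpace.gramSchmidt ℂ s with hg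
  have hspan : Submodule.span ℂ (Set.range g) = K := by
    rw [← hK, hg, InnerProductSpace.span_gramSchmidt]
  refine Submodule.eq_starProjection_of_mem_of_inner_eq_zero ?_ ?_
  · exact K.sum_mem fun i _ => K.smul_mem _ (hspan ▸ Submodule.subset_span ⟨i, rfl⟩)
  · intro w hw
    rw [← hspan] at hw
    induction hw using Submodule.span_induction with
    | mem x hx =>
      obtain ⟨j, rfl⟩ := hx
      rw [inner_eq_zero_symm, inner_sub_right, inner_sum, Finset.sum_eq_single j]
      · rw [inner_smul_right, inner_self_eq_norm_sq_to_K]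
        -- If the family is dependent some `g j` vanish; their coefficients are `0 / 0 = 0`, so the
        -- formula needs no independence.
        by_cases h0 : g j = 0
        · simp [h0]
        · have : (‖g j‖ : ℂ) ≠ 0 := by simpa using h0
          push_cast
          field_simp
          simp
      · intro i _ hij
        rw [inner_smul_right, InnerProductSpace.gramSchmidt_orthogonal ℂ s (Ne.symm hij), mul_zero]
      · simp
    | zero => simp
    | add x y _ _ hx hy => rw [inner_add_right, hx, hy, add_zero]
    | smul a x _ hx => rw [inner_smul_right, hx, mul_zero]

/-- Near each point the projection has an explicit formula in the orthogonalised local frame, and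
smoothness is local. -/
theorem IsSmoothSubbundle.isSmooth_starProjection {K : BrillouinTorus d → Submodule ℂ F}
    [∀ lam, (K lam).HasOrthogonalProjection] (hK : IsSmoothSubbundle K)
    {u : BrillouinTorus d → F} (hu : IsSmooth u) :
    IsSmooth fun lam => (K lam).starProjection (u lam) := by
  refine contDiff_iff_contDiffAt.2 fun k₀ => ?_
  obtain ⟨U, hU, n, s, hs, hsK⟩ := hK k₀
  have hg := contDiffOn_gramSchmidt hs fun k hk => (hsK k hk).1
  have hu' : ContDiffOn ℝ ((⊤ : ℕ∞) : WithTop ℕ∞) (fun k : Space d => u (torusExp k)) U :=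
    ContDiff.contDiffOn hu
  refine ContDiffOn.contDiffAt (s := U) ?_ hU
  refine ContDiffOn.congr ?_ fun k hk => starProjection_eq_sum_gramSchmidt (hsK k hk).2 _
  refine ContDiffOn.sum fun i _ => ContDiffOn.smul ?_ (hg i)
  simp_rw [div_eq_mul_inv]
  refine ((hg i).inner ℂ hu').mul (ContDiffOn.inv ?_ fun k hk => ?_)
  · exact Complex.ofRealCLM.contDiff.comp_contDiffOn ((hg i).norm_sq ℂ)
  · have := InnerProductSpace.gramSchmidt_ne_zero (𝕜 := ℂ) i (hsK k hk).1
    simpa using this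

theorem IsSmoothSubbundle.isSection_starProjection {K : BrillouinTorus d → Submodule ℂ F}
    [∀ lam, (K lam).HasOrthogonalProjection] (hK : IsSmoothSubbundle K)
    {u : BrillouinTorus d → F} (hu : IsSmooth u) :
    IsSection K fun lam => (K lam).starProjection (u lam) :=
  ⟨hK.isSmooth_starProjection hu, fun lam => (K lam).starProjection_apply_mem _⟩

end Projection

section Compression

/-- On smooth sections, `D` is the compression to `K` of the connection `dirDeriv + M` of the
trivial bundle. -/
def IsCompression (K : BrillouinTorus d → Submodule ℂ F) [∀ lam, (K lam).HasOrthogonalProjection]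
    (M : Space d → F →L[ℂ] F)
    (D : Space d → (BrillouinTorus d → F) → BrillouinTorus d → F) : Prop :=
  ∀ v s, IsSmooth s → ∀ lam,
    D v s lam = (K lam).starProjection (M v (s lam) + dirDeriv v s lam)

variable {K : BrillouinTorus d → Submodule ℂ F} [∀ lam, (K lam).HasOrthogonalProjection]
  {M : Space d → F →L[ℂ] F} {D : Space d → (BrillouinTorus d → F) → BrillouinTorus d → F}

/-- Compressing a metric connection `dirDeriv + M` of the trivial bundle to a smooth subbundle
gives a Hermitian connection. -/
theorem isHermitianConnection_of_compression (hK : IsSmoothSubbundle K)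
    (hM : ∀ (c : ℝ) v w f, M (c • v + w) f = (c : ℂ) • M v f + M w f)
    (hskew : ∀ v f g, ⟪M v f, g⟫_ℂ = -⟪f, M v g⟫_ℂ)
    (hD : IsCompression K M D) :
    IsHermitianConnection K D where
  isSection v s hs := by
    have h : D v s = fun lam => (K lam).starProjection (M v (s lam) + dirDeriv v s lam) :=
      funext (hD v s hs.smooth)
    rw [h]
    refine hK.isSection_starProjection ?_
    exact ContDiff.add (hs.smooth.continuousLinearMap_comp ((M v).restrictScalars ℝ))
      (hs.smooth.dirDeriv v)
  linear_left c v w s hs := by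
    funext lam
    rw [Pi.add_apply, Pi.smul_apply, hD _ s hs.smooth, hD _ s hs.smooth, hD _ s hs.smooth,
      ← map_smul, ← map_add, hM, hs.smooth.dirDeriv_smul_add, ← Complex.coe_smul, smul_add]
    congr 1
    abel
  linear_right v a s t hs ht := by
    funext lam
    rw [Pi.add_apply, Pi.smul_apply, hD _ _ (hs.smul_add a ht).smooth, hD _ s hs.smooth,
      hD _ t ht.smooth, ← map_smul, ← map_add, dirDeriv_smul_add hs.smooth ht.smooth,
      Pi.add_apply, Pi.smul_apply, map_add (M v), map_smul (M v), smul_add]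
    congr 1
    abel
  leibniz v s f hs hf lam := by
    rw [hD _ _ (hs.smul hf).smooth, hD _ s hs.smooth, hs.dirDeriv_smul hf, map_smul,
      add_left_comm, ← smul_add, map_add, map_smul, map_smul,
      Submodule.starProjection_eq_self_iff.2 (hs.mem lam)]
  metric v s t hs ht lam := by
    -- The self-adjoint projection fixes values of sections, so it disappears from both pairings;
    -- skewness then cancels the two terms in `M`.
    have h1 : ∀ x, ⟪(K lam).starProjection x, t lam⟫_ℂ = ⟪x, t lam⟫_ℂ := fun x => by
      rw [Submodule.inner_starProjection_left_eq_right,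
        Submodule.starProjection_eq_self_iff.2 (ht.mem lam)]
    have h2 : ∀ x, ⟪s lam, (K lam).starProjection x⟫_ℂ = ⟪s lam, x⟫_ℂ := fun x => by
      rw [← Submodule.inner_starProjection_left_eq_right,
        Submodule.starProjection_eq_self_iff.2 (hs.mem lam)]
    rw [hD _ s hs.smooth, hD _ t ht.smooth, h1, h2, dirDeriv_inner hs.smooth ht.smooth,
      inner_add_left, inner_add_right, hskew]
    ring

/-- `J` carries `K` onto `K'` and preserves orthogonality, hence respects the orthogonal
decompositions. -/
theorem starProjection_conjIsometry {K K' : Submodule ℂ F} [K.HasOrthogonalProjection]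
    [K'.HasOrthogonalProjection] {J : F →ₗᵢ⋆[ℂ] F}
    (hJ : ∀ f g, ⟪J f, J g⟫_ℂ = conj ⟪f, g⟫_ℂ) (hK : Set.BijOn J K K') (f : F) :
    K'.starProjection (J f) = J (K.starProjection f) := by
  refine Submodule.eq_starProjection_of_mem_of_inner_eq_zero
    (hK.mapsTo (K.starProjection_apply_mem f)) fun w hw => ?_
  obtain ⟨w, hw', rfl⟩ := hK.surjOn hw
  rw [← map_sub, hJ, Submodule.starProjection_inner_eq_zero _ _ hw', map_zero]

/-- The compression of a connection is preserved by a lift of the inversion under which the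
connection form is equivariant. -/
theorem preservesConnection_of_compression {J : F →ₗᵢ⋆[ℂ] F}
    (hJ : ∀ f g, ⟪J f, J g⟫_ℂ = conj ⟪f, g⟫_ℂ)
    (hJK : ∀ lam, Set.BijOn J (K lam⁻¹) (K lam))
    (hJM : ∀ v f, M v (J f) = J (M (-v) f))
    (hD : IsCompression K M D) :
    PreservesConnection K (fun _ => J) D := by
  intro v s hs
  funext lam
  have hsm : IsSmooth (liftSection (fun _ => J) s) :=
    hs.smooth.comp_inv.continuousLinearMap_comp (conjIsometryToRealCLM J)
  have h1 : dirDeriv v (liftSection (fun _ => J) s) lam = J (dirDeriv (-v) s lam⁻¹) :=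
    hs.smooth.dirDeriv_continuousLinearMap_inv (conjIsometryToRealCLM J) v lam
  rw [hD _ _ hsm, h1]
  simp only [liftSection]
  rw [hD _ _ hs.smooth, hJM, ← map_add, starProjection_conjIsometry hJ (hJK lam)]

end Compression

/-! ### Averaging connections over `ℤ₂` -/

section Average

variable {K : BrillouinTorus d → Submodule ℂ F} {τ : BrillouinTorus d → F → F}
  {D : Space d → (BrillouinTorus d → F) → BrillouinTorus d → F} {ε : ℤˣ}

theorem IsAntiunitaryLift.isSection (hτ : IsAntiunitaryLift K τ) {s : BrillouinTorus d → F}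
    (hs : IsSection K s) : IsSection K (liftSection τ s) :=
  ⟨hτ.smooth s hs, fun lam => (hτ.bijOn lam).mapsTo (hs.mem lam⁻¹)⟩

theorem IsAntiunitaryLift.liftSection_smul_add (hτ : IsAntiunitaryLift K τ) (a : ℂ)
    {s t : BrillouinTorus d → F} (hs : IsSection K s) (ht : IsSection K t) :
    liftSection τ (a • s + t) = conj a • liftSection τ s + liftSection τ t :=
  funext fun lam => hτ.antilinear lam a _ (hs.mem _) _ (ht.mem _)

theorem IsAntiunitaryLift.liftSection_zero (hτ : IsAntiunitaryLift K τ) :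
    liftSection τ (0 : BrillouinTorus d → F) = 0 := by
  have h := hτ.liftSection_smul_add 1 (IsSection.zero K) (IsSection.zero K)
  simpa using h

theorem IsAntiunitaryLift.liftSection_smul (hτ : IsAntiunitaryLift K τ) (a : ℂ)
    {s : BrillouinTorus d → F} (hs : IsSection K s) :
    liftSection τ (a • s) = conj a • liftSection τ s := by
  simpa [hτ.liftSection_zero] using hτ.liftSection_smul_add a hs (IsSection.zero K)

theorem IsAntiunitaryLift.liftSection_mul (hτ : IsAntiunitaryLift K τ)
    {s : BrillouinTorus d → F} (hs : IsSection K s) (f : BrillouinTorus d → ℂ) :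
    liftSection τ (fun m => f m • s m) = fun m => conj (f m⁻¹) • liftSection τ s m := by
  funext lam
  have h0 := hτ.antilinear lam 1 0 (K lam⁻¹).zero_mem 0 (K lam⁻¹).zero_mem
  rw [one_smul, map_one, one_smul, add_zero, left_eq_add] at h0
  have h := hτ.antilinear lam (f lam⁻¹) _ (hs.mem lam⁻¹) 0 (K lam⁻¹).zero_mem
  rwa [h0, add_zero, add_zero] at h

theorem IsSignedBundle.liftSection_liftSection (hτ : IsSignedBundle ε K τ)
    {s : BrillouinTorus d → F} (hs : IsSection K s) :
    liftSection τ (liftSection τ s) = ((ε : ℤ) : ℂ) • s := by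
  funext lam
  simp only [liftSection, inv_inv]
  exact hτ.sq lam _ (hs.mem lam)

theorem conj_unit_int (ε : ℤˣ) : conj (((ε : ℤ) : ℂ)) = ((ε : ℤ) : ℂ) := by simp

theorem unit_int_mul_self (ε : ℤˣ) : ((ε : ℤ) : ℂ) * ((ε : ℤ) : ℂ) = 1 := by
  rcases Int.units_eq_one_or ε with rfl | rfl <;> simp

theorem IsConnection.neg_smul_add (hD : IsConnection K D) {s : BrillouinTorus d → F}
    (hs : IsSection K s) (c : ℝ) (v w : Space d) :
    D (-(c • v + w)) s = (c : ℂ) • D (-v) s + D (-w) s := by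
  rw [neg_add, ← smul_neg, hD.linear_left c _ _ s hs]

theorem IsConnection.smul_right (hD : IsConnection K D) {s : BrillouinTorus d → F}
    (hs : IsSection K s) (v : Space d) (a : ℂ) : D v (a • s) = a • D v s := by
  have h0 := hD.linear_right v 1 0 0 (IsSection.zero K) (IsSection.zero K)
  have h := hD.linear_right v a s 0 hs (IsSection.zero K)
  simp only [smul_zero, add_zero, one_smul, left_eq_add] at h0 h
  rwa [h0, add_zero] at h

/-- The transform of `D` by `τ` is again a connection, and the weights add up to 1. In its Leibniz
rule `f` is first replaced by `conj (f m⁻¹)`; the direction `-v` absorbs the sign from the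
inversion, and the outer `τ` undoes the conjugation. -/
theorem IsSignedBundle.isConnection_average (hτ : IsSignedBundle ε K τ) (hD : IsConnection K D) :
    IsConnection K (averageConnection ε τ D) := by
  have hτs : ∀ {s}, IsSection K s → IsSection K (((ε : ℤ) : ℂ) • liftSection τ s) := fun hs =>
    (hτ.isSection hs).const_smul _
  refine ⟨fun v s hs => ?_, fun c v w s hs => ?_, fun v a s t hs ht => ?_,
    fun v s f hs hf lam => ?_⟩
  · exact ((hD.isSection v s hs).add
      (hτ.isSection (hD.isSection _ _ (hτs hs)))).const_smul _
  · simp only [averageConnection]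
    rw [hD.linear_left c v w s hs, hD.neg_smul_add (hτs hs),
      hτ.liftSection_smul_add _ (hD.isSection _ _ (hτs hs)) (hD.isSection _ _ (hτs hs)),
      Complex.conj_ofReal]
    module
  · simp only [averageConnection]
    have h1 : ((ε : ℤ) : ℂ) • liftSection τ (a • s + t) =
        conj a • (((ε : ℤ) : ℂ) • liftSection τ s) + ((ε : ℤ) : ℂ) • liftSection τ t := by
      rw [hτ.liftSection_smul_add a hs ht]
      module
    rw [h1, hD.linear_right v a s t hs ht, hD.linear_right _ _ _ _ (hτs hs) (hτs ht),
      hτ.liftSection_smul_add _ (hD.isSection _ _ (hτs hs)) (hD.isSection _ _ (hτs ht)),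
      Complex.conj_conj]
    module
  · have hf' : IsSmooth fun m => conj (f m⁻¹) :=
      hf.comp_inv.continuousLinearMap_comp Complex.conjCLE.toContinuousLinearMap
    have h1 : ((ε : ℤ) : ℂ) • liftSection τ (fun m => f m • s m) =
        fun m => conj (f m⁻¹) • (((ε : ℤ) : ℂ) • liftSection τ s) m := by
      rw [hτ.liftSection_mul hs f]
      funext m
      simp only [Pi.smul_apply]
      rw [smul_comm]
    have h2 : dirDeriv (-v) (fun m => conj (f m⁻¹)) lam⁻¹ = conj (dirDeriv v f lam) := by
      have h := hf.dirDeriv_continuousLinearMap_inv Complex.conjCLE.toContinuousLinearMap (-v) lam⁻¹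
      simpa using h
    have h3 : liftSection τ (D (-v) (((ε : ℤ) : ℂ) • liftSection τ fun m => f m • s m)) lam =
        dirDeriv v f lam • s lam +
          f lam • liftSection τ (D (-v) (((ε : ℤ) : ℂ) • liftSection τ s)) lam := by
      have hsec := hτs hs
      rw [h1]
      simp only [liftSection]
      rw [hD.leibniz _ _ _ hsec hf' lam⁻¹, h2, inv_inv]
      have h4 := hτ.antilinear lam (conj (f lam)) _ ((hD.isSection (-v) _ hsec).mem lam⁻¹)
        _ ((K lam⁻¹).smul_mem (conj (dirDeriv v f lam)) (hsec.mem lam⁻¹))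
      rw [add_comm] at h4
      rw [h4, Complex.conj_conj, add_comm]
      -- In the derivative term `τ` meets `ε τ s`, and `ε τ² = 1` gives back `s`.
      have h5 : liftSection τ (fun m => conj (dirDeriv v f m⁻¹) •
          (((ε : ℤ) : ℂ) • liftSection τ s) m) lam = dirDeriv v f lam • s lam := by
        rw [hτ.liftSection_mul hsec, hτ.liftSection_smul _ (hτ.isSection hs),
          hτ.liftSection_liftSection hs, conj_unit_int, smul_smul, unit_int_mul_self]
        simp
      simp only [liftSection, inv_inv] at h5
      rw [← h5]
    have h6 := hD.leibniz v s f hs hf lam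
    simp only [averageConnection, Pi.smul_apply, Pi.add_apply]
    rw [h3, h6]
    module

/-- Transport by `τ` exchanges the two summands, because `ε τ` is inverse to `τ`. -/
theorem IsSignedBundle.preservesConnection_average (hτ : IsSignedBundle ε K τ)
    (hD : IsConnection K D) : PreservesConnection K τ (averageConnection ε τ D) := by
  intro v s hs
  have hτs := hτ.isSection hs
  simp only [averageConnection, neg_neg]
  have h1 := hD.isSection v _ hτs
  rw [hτ.liftSection_liftSection hs, smul_smul, unit_int_mul_self, one_smul,
    hD.smul_right hτs, hτ.liftSection_smul _ ((hD.isSection (-v) s hs).add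
      (hτ.isSection (h1.const_smul _)))]
  have h2 := hτ.liftSection_smul_add 1 (hD.isSection (-v) s hs)
    (hτ.isSection (h1.const_smul ((ε : ℤ) : ℂ)))
  rw [one_smul, map_one, one_smul] at h2
  rw [h2, hτ.liftSection_liftSection (h1.const_smul _), smul_smul, unit_int_mul_self, one_smul,
    add_comm, map_div₀, map_one, Complex.conj_ofNat]

/-- Averaging does not change an invariant connection. -/
theorem IsSignedBundle.average_eq_self (hτ : IsSignedBundle ε K τ)
    (hp : PreservesConnection K τ D) (v : Space d) {s : BrillouinTorus d → F}
    (hs : IsSection K s) : averageConnection ε τ D v s = D v s := by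
  have hτs := hτ.isSection hs
  simp only [averageConnection]
  rw [← hp v _ (hτs.const_smul _), hτ.liftSection_smul _ hτs, hτ.liftSection_liftSection hs,
    conj_unit_int, smul_smul, unit_int_mul_self, one_smul]
  module

/-- For a preserved `D` the average agrees with `D` on sections, so the metric identity is
inherited. -/
theorem IsSignedBundle.isHermitianConnection_average (hτ : IsSignedBundle ε K τ)
    (hD : IsHermitianConnection K D) (hp : PreservesConnection K τ D) :
    IsHermitianConnection K (averageConnection ε τ D) where
  toIsConnection := hτ.isConnection_average hD.toIsConnection
  metric v s t hs ht lam := by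
    rw [hτ.average_eq_self hp v hs, hτ.average_eq_self hp v ht]
    exact hD.metric v s t hs ht lam

end Average

end Bundles

/-! ### Parallel transport and its generator, the position operator -/

/-- Differentiation of a section along a transport with generator `M`. -/
theorem hasDerivAt_transport {F : Type*} [NormedAddCommGroup F] [InnerProductSpace ℂ F]
    {P : ℝ → F → F} {M : F →L[ℂ] F} {c : ℝ}
    (hP : ∀ t : ℝ, |t| * c ≤ 1 → ∀ f, ‖P t f - (f + (t : ℂ) • M f)‖ ≤ (|t| * c) ^ 2 * ‖f‖)
    {g : ℝ → F} {g' : F} (hg : HasDerivAt g g' 0) :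
    HasDerivAt (fun t => P t (g t)) (M (g 0) + g') 0 := by
  have h1 : HasDerivAt (fun t => g t + t • M (g t)) (g' + M (g 0)) 0 := by
    have h : HasDerivAt (fun t => g t + t • M (g t))
        (g' + ((0 : ℝ) • M g' + (1 : ℝ) • M (g 0))) 0 :=
      hg.add ((hasDerivAt_id (0 : ℝ)).smul
        ((M.restrictScalars ℝ).hasFDerivAt.comp_hasDerivAt (0 : ℝ) hg))
    simpa using h
  -- The error is at most `(|t| c)² ‖g t‖` with `g` bounded near 0, hence `O(t²)`, and it
  -- contributes no derivative.
  have h2 : HasDerivAt (fun t => P t (g t) - (g t + t • M (g t))) 0 0 := by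
    have h0 : P 0 (g 0) - (g 0 + (0 : ℝ) • M (g 0)) = 0 := by
      have h := hP 0 (by simp) (g 0)
      simpa using h
    rw [hasDerivAt_iff_isLittleO, h0]
    simp only [sub_zero, smul_zero]
    have hbig : (fun t => P t (g t) - (g t + t • M (g t))) =O[𝓝 0] fun t : ℝ => t ^ 2 := by
      refine Asymptotics.IsBigO.of_bound (c ^ 2 * (‖g 0‖ + 1)) ?_
      have e1 : ∀ᶠ t in 𝓝 (0 : ℝ), ‖g t‖ < ‖g 0‖ + 1 :=
        hg.continuousAt.norm.eventually_lt_const (by simp)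
      have e2 : ∀ᶠ t in 𝓝 (0 : ℝ), |t| * c < 1 := by
        have hc : ContinuousAt (fun t : ℝ => |t| * c) 0 := by fun_prop
        exact hc.eventually_lt_const (by simp)
      filter_upwards [e1, e2] with t ht1 ht2
      have h := hP t ht2.le (g t)
      rw [Complex.coe_smul] at h
      refine h.trans ?_
      rw [mul_pow, sq_abs, Real.norm_of_nonneg (sq_nonneg t)]
      calc t ^ 2 * c ^ 2 * ‖g t‖ ≤ t ^ 2 * c ^ 2 * (‖g 0‖ + 1) := by gcongr
        _ = c ^ 2 * (‖g 0‖ + 1) * t ^ 2 := by ring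
    refine hbig.trans_isLittleO ?_
    simpa using Asymptotics.isLittleO_pow_pow (𝕜 := ℝ) (m := 1) (n := 2) (by norm_num)
  have h3 := h2.add h1
  simp only [zero_add] at h3
  rw [add_comm]
  convert h3 using 2
  simp

theorem transportDeriv_apply {d : ℕ} {F : Type*} [NormedAddCommGroup F] [InnerProductSpace ℂ F]
    {P : Space d → F → F} {v : Space d} {M : F →L[ℂ] F} {c : ℝ}
    (hP : ∀ t : ℝ, |t| * c ≤ 1 → ∀ f,
      ‖P (-(t • v)) f - (f + (t : ℂ) • M f)‖ ≤ (|t| * c) ^ 2 * ‖f‖)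
    {s : BrillouinTorus d → F} (hs : IsSmooth s) (lam : BrillouinTorus d) :
    transportDeriv P v s lam = M (s lam) + dirDeriv v s lam := by
  have h := hasDerivAt_transport (P := fun t => P (-(t • v))) hP (hs.hasDerivAt v lam)
  rw [mul_torusExp_zero_smul] at h
  exact h.deriv

section Position

variable {d : ℕ} {V : Type*} [NormedAddCommGroup V] [InnerProductSpace ℂ V]

theorem norm_le_of_mem_unitCell {x : Space d} (hx : x ∈ unitCell d) : ‖x‖ ≤ Real.sqrt d := by
  rw [EuclideanSpace.norm_eq]
  refine Real.sqrt_le_sqrt ?_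
  calc ∑ i, ‖x i‖ ^ 2 ≤ ∑ _i : Fin d, (1 : ℝ) := by
        refine Finset.sum_le_sum fun i _ => ?_
        rw [Real.norm_of_nonneg (hx i).1]
        exact pow_le_one₀ (hx i).1 (hx i).2.le
    _ = d := by simp

/-- The function `2πi⟨v, x - x₀⟩`. -/
noncomputable def positionForm (x₀ v x : Space d) : ℂ :=
  2 * Real.pi * Complex.I * (⟪v, x - x₀⟫_ℝ : ℝ)

/-- A bound for `2πi⟨v, x - x₀⟩` on the unit cell. -/
noncomputable def positionBound (x₀ v : Space d) : ℝ :=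
  2 * Real.pi * (‖v‖ * (Real.sqrt d + ‖x₀‖))

theorem norm_positionForm_le (x₀ v : Space d) {x : Space d} (hx : x ∈ unitCell d) :
    ‖positionForm x₀ v x‖ ≤ positionBound x₀ v := by
  have h1 : ‖positionForm x₀ v x‖ = 2 * Real.pi * ‖⟪v, x - x₀⟫_ℝ‖ := by
    simp [positionForm, abs_of_pos Real.pi_pos]
  rw [h1, positionBound]
  gcongr
  refine (norm_inner_le_norm _ _).trans ?_
  gcongr
  exact (norm_sub_le _ _).trans (by gcongr; exact norm_le_of_mem_unitCell hx)

theorem conj_positionForm (x₀ v x : Space d) :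
    conj (positionForm x₀ v x) = -positionForm x₀ v x := by
  simp [positionForm, Complex.conj_ofNat]

theorem positionForm_neg (x₀ v x : Space d) : positionForm x₀ (-v) x = -positionForm x₀ v x := by
  simp [positionForm]

theorem ae_norm_positionForm_smul_le (x₀ v : Space d) (f : BlochFibre d V) :
    ∀ᵐ x ∂(volume.restrict (unitCell d)),
      ‖positionForm x₀ v x • f x‖ ≤ positionBound x₀ v * ‖f x‖ := by
  filter_upwards [ae_restrict_mem measurableSet_unitCell] with x hx
  rw [norm_smul]
  gcongr
  exact norm_positionForm_le x₀ v hx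

theorem memLp_positionForm_smul (x₀ v : Space d) (f : BlochFibre d V) :
    MemLp (fun x => positionForm x₀ v x • f x) 2 (volume.restrict (unitCell d)) := by
  refine (Lp.memLp f).of_le_mul (c := positionBound x₀ v) ?_ (ae_norm_positionForm_smul_le x₀ v f)
  refine AEStronglyMeasurable.smul (Continuous.aestronglyMeasurable ?_) (Lp.memLp f).1
  unfold positionForm
  fun_prop

variable (V) in
/-- Multiplication by `2πi⟨v, x - x₀⟩` on the fibres of `E`. -/
noncomputable def positionOperator (x₀ v : Space d) : BlochFibre d V →L[ℂ] BlochFibre d V :=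
  LinearMap.mkContinuous
    { toFun := fun f => (memLp_positionForm_smul x₀ v f).toLp _
      map_add' := fun f g => by
        rw [← MemLp.toLp_add, MemLp.toLp_eq_toLp_iff]
        filter_upwards [Lp.coeFn_add f g] with x hx
        rw [hx, Pi.add_apply, Pi.add_apply, smul_add]
      map_smul' := fun c f => by
        rw [RingHom.id_apply, ← MemLp.toLp_const_smul, MemLp.toLp_eq_toLp_iff]
        filter_upwards [Lp.coeFn_smul c f] with x hx
        rw [hx, Pi.smul_apply, Pi.smul_apply, smul_comm] }
    (positionBound x₀ v) fun f => by
      refine Lp.norm_le_mul_norm_of_ae_le_mul ?_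
      filter_upwards [ae_norm_positionForm_smul_le x₀ v f,
        (memLp_positionForm_smul x₀ v f).coeFn_toLp] with x h1 h2
      exact (congrArg norm h2).le.trans h1

theorem coeFn_positionOperator (x₀ v : Space d) (f : BlochFibre d V) :
    positionOperator V x₀ v f =ᵐ[volume.restrict (unitCell d)]
      fun x => positionForm x₀ v x • f x :=
  (memLp_positionForm_smul x₀ v f).coeFn_toLp

theorem positionOperator_smul_add (x₀ : Space d) (c : ℝ) (v w : Space d) (f : BlochFibre d V) :
    positionOperator V x₀ (c • v + w) f =
      (c : ℂ) • positionOperator V x₀ v f + positionOperator V x₀ w f := by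
  refine Lp.ext ?_
  filter_upwards [coeFn_positionOperator x₀ (c • v + w) f, coeFn_positionOperator x₀ v f,
    coeFn_positionOperator x₀ w f,
    Lp.coeFn_add ((c : ℂ) • positionOperator V x₀ v f) (positionOperator V x₀ w f),
    Lp.coeFn_smul (c : ℂ) (positionOperator V x₀ v f)] with x h1 h2 h3 h4 h5
  rw [h1, h4, Pi.add_apply, h5, Pi.smul_apply, h2, h3, smul_smul, ← add_smul]
  congr 1
  simp only [positionForm, inner_add_left, real_inner_smul_left]
  push_cast
  ring

theorem inner_positionOperator_left (x₀ v : Space d) (f g : BlochFibre d V) :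
    ⟪positionOperator V x₀ v f, g⟫_ℂ = -⟪f, positionOperator V x₀ v g⟫_ℂ := by
  rw [L2.inner_def, L2.inner_def, ← integral_neg]
  refine integral_congr_ae ?_
  filter_upwards [coeFn_positionOperator x₀ v f, coeFn_positionOperator x₀ v g] with x h1 h2
  rw [h1, h2, inner_smul_left, inner_smul_right, conj_positionForm, neg_mul]

/-- `J` conjugates the multiplier. The multiplier is imaginary and odd in `v`, so the sign from
conjugation cancels the one from `-v`. -/
theorem IsLocalMap.positionOperator_comm {J : BlochFibre d V →ₗᵢ⋆[ℂ] BlochFibre d V}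
    (hJ : IsLocalMap J) (x₀ v : Space d) (f : BlochFibre d V) :
    positionOperator V x₀ v (J f) = J (positionOperator V x₀ (-v) f) := by
  refine Lp.ext ?_
  filter_upwards [coeFn_positionOperator x₀ v (J f),
    hJ.map_mul (coeFn_positionOperator x₀ (-v) f)] with x h1 h2
  rw [h1, h2, conj_positionForm, positionForm_neg, neg_neg]

/-- Pointwise this is `|exp z - 1 - z| ≤ |z|²` for `|z| ≤ 1`, with `z = 2πi t⟨v, x - x₀⟩` bounded
uniformly on the cell. It makes the transport differentiable in operator norm. -/
theorem norm_blochTransport_sub_le (x₀ v : Space d) (t : ℝ) (ht : |t| * positionBound x₀ v ≤ 1)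
    (f : BlochFibre d V) :
    ‖blochTransport x₀ (-(t • v)) f - (f + (t : ℂ) • positionOperator V x₀ v f)‖ ≤
      (|t| * positionBound x₀ v) ^ 2 * ‖f‖ := by
  refine Lp.norm_le_mul_norm_of_ae_le_mul ?_
  have h0 : blochTransport x₀ (-(t • v)) f =ᵐ[volume.restrict (unitCell d)] fun x =>
      Complex.exp (-(2 * Real.pi * Complex.I * (⟪-(t • v), x - x₀⟫_ℝ : ℝ))) • f x :=
    MemLp.coeFn_toLp _
  filter_upwards [h0, coeFn_positionOperator x₀ v f,
    Lp.coeFn_sub (blochTransport x₀ (-(t • v)) f) (f + (t : ℂ) • positionOperator V x₀ v f),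
    Lp.coeFn_add f ((t : ℂ) • positionOperator V x₀ v f),
    Lp.coeFn_smul (t : ℂ) (positionOperator V x₀ v f),
    ae_restrict_mem measurableSet_unitCell] with x h1 h2 h3 h4 h5 hx
  have hexp : -(2 * Real.pi * Complex.I * (⟪-(t • v), x - x₀⟫_ℝ : ℝ)) =
      t * positionForm x₀ v x := by
    simp only [positionForm, inner_neg_left, real_inner_smul_left]
    push_cast
    ring
  have hz : ‖(t : ℂ) * positionForm x₀ v x‖ ≤ |t| * positionBound x₀ v := by
    rw [norm_mul, Complex.norm_real, Real.norm_eq_abs]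
    gcongr
    exact norm_positionForm_le x₀ v hx
  rw [h3, Pi.sub_apply, h4, Pi.add_apply, h5, Pi.smul_apply, h1, h2, hexp, smul_smul]
  set z := (t : ℂ) * positionForm x₀ v x
  have heq : Complex.exp z • f x - (f x + z • f x) = (Complex.exp z - 1 - z) • f x := by module
  rw [heq, norm_smul]
  gcongr
  exact (Complex.norm_exp_sub_one_sub_id_le (hz.trans ht)).trans (by gcongr)

end Position

/-! ### Symmetry of the Bloch bundle and of the Berry connection -/

namespace BandInsulator

variable {d : ℕ} {V : Type*} [NormedAddCommGroup V] [InnerProductSpace ℂ V]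
  [CompleteSpace V] {Q : Type*} [Group Q] [TopologicalSpace Q]
  {e : QuantumExtension ℤˣ Q (MonoidHom.id ℤˣ)} (B : BandInsulator d V e) {T : Q}
  (hT : e.q T = -1)

theorem eq_of_mem_graph {H : Type*} [NormedAddCommGroup H] [InnerProductSpace ℂ H]
    {A : H →ₗ.[ℂ] H} {R : H →L[ℂ] H} (hR : IsBoundedInverse A R) {f g : H}
    (h : (f, g) ∈ A.graph) : R g = f := by
  obtain ⟨x, rfl, rfl⟩ := (LinearPMap.mem_graph_iff A).1 h
  exact hR.2 x

theorem isBlochTransform_ρ {ψ : Wavefunction d V} {s : BrillouinTorus d → BlochFibre d V}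
    (hs : IsBlochTransform ψ s) :
    IsBlochTransform (B.ρ (1, T) ψ) (liftSection (fun _ => B.fibreMap T hT) s) :=
  isBlochTransform_of_cellPiece _ (fun n => B.cellPiece_ρ hT n ψ) hs

/-- The inverses of the Bloch Hamiltonians are equivariant. -/
theorem inverse_fibreMap {R : BrillouinTorus d → BlochFibre d V →L[ℂ] BlochFibre d V}
    (hcont : Continuous R) (hR : ∀ lam, IsBoundedInverse (B.blochHam lam) (R lam))
    (lam : BrillouinTorus d) (y : BlochFibre d V) :
    R lam (B.fibreMap T hT y) = B.fibreMap T hT (R lam⁻¹ y) := by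
  have hs : Continuous fun lam => R lam y := hcont.clm_apply continuous_const
  -- The Hamiltonian is tested on the sections `R lam y` and `y`. Both are continuous, so they come
  -- from wavefunctions, and fibrewise they lie in the graphs of the Bloch Hamiltonians.
  obtain ⟨ψ, hψ⟩ := exists_isBlochTransform hs
  obtain ⟨χ, hχ⟩ := exists_isBlochTransform (s := fun _ : BrillouinTorus d => y) continuous_const
  have h1 : (ψ, χ) ∈ B.ham.graph :=
    (B.decomposition _ _ _ _ hψ hχ).2 (Filter.Eventually.of_forall fun k => (hR _).1 y)
  have h2 := (B.decomposition _ _ _ _ (B.isBlochTransform_ρ hT hψ)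
    (B.isBlochTransform_ρ hT hχ)).1 (B.symmetric (1, T) _ _ h1)
  have h3 : (fun lam => R lam (B.fibreMap T hT y)) = fun lam => B.fibreMap T hT (R lam⁻¹ y) := by
    refine eq_of_ae_eq_unitCell (hcont.clm_apply continuous_const)
      ((B.fibreMap T hT).continuous.comp (hs.comp continuous_inv)) ?_
    filter_upwards [h2] with k hk
    exact eq_of_mem_graph (hR _) hk
  exact congrFun h3 lam

/-- An eigenvector satisfies `v = R (μ v)`, which transfers through the equivariant inverses without
touching unbounded domains; `μ` is real, so conjugation leaves it alone. -/
theorem mapsTo_fibreMap (lam : BrillouinTorus d) :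
    Set.MapsTo (B.fibreMap T hT) (B.blochBundle lam⁻¹) (B.blochBundle lam) := by
  obtain ⟨R, hcont, hR⟩ := B.continuous_blochHam
  intro f hf
  change f ∈ Submodule.span ℂ _ at hf
  induction hf using Submodule.span_induction with
  | mem v hv =>
    obtain ⟨μ, hμ, hv⟩ := hv
    refine Submodule.subset_span ⟨μ, hμ, ?_⟩
    have h1 := (hR lam).1 (B.fibreMap T hT ((μ : ℂ) • v))
    rwa [B.inverse_fibreMap hT hcont hR, eq_of_mem_graph (hR _) hv, map_smulₛₗ,
      Complex.conj_ofReal] at h1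
  | zero => simp
  | add x y _ _ hx hy =>
    rw [map_add]
    exact (B.blochBundle lam).add_mem hx hy
  | smul a x _ hx =>
    rw [map_smulₛₗ]
    exact (B.blochBundle lam).smul_mem _ hx

theorem fibreMap_fibreMap_unit {ε : ℤˣ} {u : Circle} (hu : T * T = e.ι u)
    (hε : (u : ℂ) = ((ε : ℤ) : ℂ)) (f : BlochFibre d V) :
    B.fibreMap T hT (B.fibreMap T hT f) = ((ε : ℤ) : ℂ) • f := by
  rw [B.fibreMap_fibreMap hT hu, hε]

/-- Invariance under `J` alone suffices, since `J` has the inverse `J ∘ ε`. -/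
theorem bijOn_fibreMap {K : BrillouinTorus d → Submodule ℂ (BlochFibre d V)} {ε : ℤˣ} {u : Circle}
    (hu : T * T = e.ι u) (hε : (u : ℂ) = ((ε : ℤ) : ℂ))
    (hK : ∀ lam, Set.MapsTo (B.fibreMap T hT) (K lam⁻¹) (K lam)) (lam : BrillouinTorus d) :
    Set.BijOn (B.fibreMap T hT) (K lam⁻¹) (K lam) := by
  refine ⟨hK lam, (B.fibreMap T hT).injective.injOn, fun f hf => ?_⟩
  have h1 := hK lam⁻¹
  rw [inv_inv] at h1
  refine ⟨B.fibreMap T hT (((ε : ℤ) : ℂ) • f), h1 ((K lam).smul_mem _ hf), ?_⟩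
  rw [B.fibreMap_fibreMap_unit hT hu hε, smul_smul, unit_int_mul_self, one_smul]

theorem isAntiunitaryLift_fibreMap {K : BrillouinTorus d → Submodule ℂ (BlochFibre d V)} {ε : ℤˣ}
    {u : Circle} (hu : T * T = e.ι u) (hε : (u : ℂ) = ((ε : ℤ) : ℂ))
    (hK : ∀ lam, Set.MapsTo (B.fibreMap T hT) (K lam⁻¹) (K lam)) :
    IsAntiunitaryLift K fun _ => B.fibreMap T hT where
  bijOn := B.bijOn_fibreMap hT hu hε hK
  antilinear lam a f _ g _ := by rw [map_add, map_smulₛₗ]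
  inner lam f _ g _ := B.inner_fibreMap hT f g
  smooth s hs := hs.smooth.comp_inv.continuousLinearMap_comp
    (conjIsometryToRealCLM (B.fibreMap T hT))

theorem isFibreAction_fibreMap {ε : ℤˣ} {u : Circle} (hu : T * T = e.ι u)
    (hε : (u : ℂ) = ((ε : ℤ) : ℂ)) : B.IsFibreAction T fun _ => B.fibreMap T hT where
  lift := B.isAntiunitaryLift_fibreMap hT hu hε fun _ _ _ => trivial
  equivariant _ _ hs := B.isBlochTransform_ρ hT hs

theorem isSignedBundle_fibreMap {ε : ℤˣ} {u : Circle} (hu : T * T = e.ι u)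
    (hε : (u : ℂ) = ((ε : ℤ) : ℂ)) :
    IsSignedBundle ε B.blochBundle fun _ => B.fibreMap T hT where
  toIsAntiunitaryLift := B.isAntiunitaryLift_fibreMap hT hu hε (B.mapsTo_fibreMap hT)
  bundle := B.smooth_negative
  sq _ f _ := B.fibreMap_fibreMap_unit hT hu hε f

/-- The second-order transport estimate identifies the derivative of parallel transport with `d +
M`. -/
theorem isCompression_berryConnection (x₀ : Space d) :
    IsCompression B.blochBundle (positionOperator V x₀) (B.berryConnection x₀) := by
  intro v s hs lam
  have h0 := norm_blochTransport_sub_le (V := V) x₀ v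
  have h1 := transportDeriv_apply (P := blochTransport x₀) (M := positionOperator V x₀ v)
    (v := v) (fun t ht f => h0 t ht f) hs lam
  unfold berryConnection blochConnection
  rw [h1]

theorem isHermitianConnection_berryConnection (x₀ : Space d) :
    IsHermitianConnection B.blochBundle (B.berryConnection x₀) :=
  isHermitianConnection_of_compression (M := positionOperator V x₀) B.smooth_negative
    (positionOperator_smul_add x₀) (inner_positionOperator_left x₀)
    (B.isCompression_berryConnection x₀)

theorem preservesConnection_berryConnection {ε : ℤˣ} {u : Circle} (hu : T * T = e.ι u)
    (hε : (u : ℂ) = ((ε : ℤ) : ℂ)) (x₀ : Space d) :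
    PreservesConnection B.blochBundle (fun _ => B.fibreMap T hT) (B.berryConnection x₀) :=
  preservesConnection_of_compression (M := positionOperator V x₀) (B.inner_fibreMap hT)
    (B.bijOn_fibreMap hT hu hε (B.mapsTo_fibreMap hT))
    (fun v f => (B.isLocalMap_fibreMap hT).positionOperator_comm x₀ v f)
    (B.isCompression_berryConnection x₀)

end BandInsulator

end BlochTheory

theorem mainTheorem12 {d : ℕ} {V : Type*} [NormedAddCommGroup V] [InnerProductSpace ℂ V]
    [FiniteDimensional ℂ V] [CompleteSpace V] {Q : Type*} [Group Q] [TopologicalSpace Q]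
    [IsTopologicalGroup Q] (e : BlochTheory.QuantumExtension ℤˣ Q (MonoidHom.id ℤˣ))
    (B : BlochTheory.BandInsulator d V e) (x₀ : BlochTheory.Space d) :
    BlochTheory.IsHermitianConnection B.blochBundle (B.berryConnection x₀) ∧
    ∀ T : Q, e.q T = -1 → ∃ τ, B.IsFibreAction T τ ∧
      (e.IsTrivial →
        BlochTheory.IsRealBundle B.blochBundle τ ∧
        BlochTheory.PreservesConnection B.blochBundle τ (B.berryConnection x₀)) ∧
      (¬ e.IsTrivial →
        BlochTheory.IsQuaternionicBundle B.blochBundle τ ∧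
        BlochTheory.IsHermitianConnection B.blochBundle
          (BlochTheory.averageConnection (-1) τ (B.berryConnection x₀)) ∧
        BlochTheory.PreservesConnection B.blochBundle τ
          (BlochTheory.averageConnection (-1) τ (B.berryConnection x₀)) ∧
        ∀ D, BlochTheory.IsConnection B.blochBundle D →
          BlochTheory.IsConnection B.blochBundle
            (BlochTheory.averageConnection (-1) τ D) ∧
          BlochTheory.PreservesConnection B.blochBundle τ
            (BlochTheory.averageConnection (-1) τ D)) := by
  refine ⟨B.isHermitianConnection_berryConnection x₀, fun T hT =>
    ⟨fun _ => B.fibreMap T hT, ?_⟩⟩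
  by_cases he : e.IsTrivial
  · have hu : T * T = e.ι 1 := by rw [he.mul_self hT, map_one]
    have hε : ((1 : Circle) : ℂ) = (((1 : ℤˣ) : ℤ) : ℂ) := by simp
    exact ⟨B.isFibreAction_fibreMap hT hu hε, fun _ => ⟨B.isSignedBundle_fibreMap hT hu hε,
      B.preservesConnection_berryConnection hT hu hε x₀⟩, fun h => absurd he h⟩
  · have hu := BlochTheory.QuantumExtension.mul_self_of_not_isTrivial he hT
    have hε : ((-1 : Circle) : ℂ) = (((-1 : ℤˣ) : ℤ) : ℂ) := by simp
    have hτ := B.isSignedBundle_fibreMap hT hu hε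
    have hD := B.isHermitianConnection_berryConnection x₀
    exact ⟨B.isFibreAction_fibreMap hT hu hε, fun h => absurd h he, fun _ =>
      -- The Berry connection is preserved in the Quaternionic case too, which is what makes its
      -- average Hermitian.
      ⟨hτ, hτ.isHermitianConnection_average hD
        (B.preservesConnection_berryConnection hT hu hε x₀),
      hτ.preservesConnection_average hD.toIsConnection,
      fun _ h => ⟨hτ.isConnection_average h, hτ.preservesConnection_average h⟩⟩⟩
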